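/- Let $k$ be a field and let $A$ be a (left and right) noetherian Hopf algebra over $k$ with counit $\epsilon$, coproduct $\Delta(a)=\sum a_1\otimes a_2$ and bijective antipode $S$. Put $A^e=A\otimes_k A^{\mathrm{op}}$, so that $A^e$-modules are the $k$-central $A$-bimodules, and let $k$ also denote the trivial $A$-bimodule given by $\epsilon$. For algebra automorphisms $\sigma,\tau$ of $A$ and a bimodule $M$, let ${}^{\sigma}M^{\tau}$ be $M$ with the actions $a\cdot m\cdot b=\sigma(a)\,m\,\tau(b)$. Assume that $A$ is AS-Gorenstein of injective dimension $d$: $\operatorname{injdim}{}_AA=d<\infty$, $\dim_k\operatorname{Ext}^d_A({}_Ak,{}_AA)=1$, $\operatorname{Ext}^i_A({}_Ak,{}_AA)=0$ for all $i\ne d$, and the same statements hold for right modules. Let $\int^l=\operatorname{Ext}^d_A({}_Ak,{}_AA)$ be the left integral of $A$, an $A$-bimodule through the right actions on $k$ and on $A$; let $\pi_0:A\to A/\mathrm{r.ann}(\int^l)=k$ be the canonical algebra map and let $\xi$ be the left winding automorphism $\xi(a)=\sum\pi_0(a_1)a_2$. Put $\nu=\xi S^2$. Then: (a) $A$ is rigid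 Gorenstein with Nakayama automorphism $\nu$; that is, $A$ has left and right injective dimension $d$ and, as $A$-bimodules, $$\operatorname{Ext}^i_{A^e}(A,A^e)\cong\begin{cases}0,& i\neq d,\\ {}^{1}A^{\nu},& i=d.\end{cases}$$ (b) The complex $R={}^{\nu}A^{1}[d]$ is a rigid dualising complex of $A$. That is, $R$ is a bounded complex of $A$-bimodules which has finite injective dimension and finitely generated total cohomology on each side, the canonical morphisms $A\to\operatorname{RHom}_A(R,R)$ and $A\to\operatorname{RHom}_{A^{\mathrm{op}}}(R,R)$ are isomorphisms in the derived category, and $R\cong\operatorname{RHom}_{A^e}(A,R\otimes_k R^{\mathrm{op}})$ in the derived category of $A^e$-modules. (c) As $A$-bimodules, $\int^l\cong{}^{1}k^{\nu}\cong{}^{1}k^{\xi}$. -/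

import Mathlib

open CategoryTheory TensorProduct MulOpposite
open scoped ModuleCat

universe u

noncomputable section

namespace HopfDuality

/-! ## Bimodules, twists, restriction -/

section Bimodules

variable (k A : Type u) [Field k] [Ring A] [Algebra k A]

/-- The enveloping algebra `A ⊗ Aᵒᵖ`. A `k`-central `A`-bimodule is a module over it, with
`a · m · b = (a ⊗ op b) • m`. -/
abbrev Env : Type u := A ⊗[k] Aᵐᵒᵖ

variable {A}

/-- The element `a ⊗ 1`: left multiplication by `a`. -/
abbrev envL (a : A) : Env k A := a ⊗ₜ[k] (1 : Aᵐᵒᵖ)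

/-- The element `1 ⊗ op b`: right multiplication by `b`. -/
abbrev envR (b : A) : Env k A := (1 : A) ⊗ₜ[k] op b

variable (A)

/-- `A` as an `A`-bimodule: `(a ⊗ op b) • x = a * x * b`. -/
def regularBimodule : ModuleCat.{u} (Env k A) :=
  letI : Module (Env k A) A := TensorProduct.Algebra.module
  ModuleCat.of (Env k A) A

variable {k A}

/-- The algebra map `Aᵉ → k`, `a ⊗ op b ↦ ε a * ε b` given by an augmentation `ε`. -/
def envAugmentation (ε : A →ₐ[k] k) : Env k A →ₐ[k] k :=
  Algebra.TensorProduct.lift ε (AlgHom.fromOpposite ε fun _ _ => Commute.all _ _)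
    fun _ _ => Commute.all _ _

/-- The trivial bimodule `k`, with `a · x · b = ε a * x * ε b`. -/
def trivialBimodule (ε : A →ₐ[k] k) : ModuleCat.{u} (Env k A) :=
  (ModuleCat.restrictScalars (envAugmentation ε).toRingHom).obj (ModuleCat.of k k)

/-- The twisted bimodule `^σ M ^τ`: the same group, with `a · m · b = σ a · m · τ b`. -/
def twist (σ τ : A ≃ₐ[k] A) (M : ModuleCat.{u} (Env k A)) : ModuleCat.{u} (Env k A) :=
  (ModuleCat.restrictScalars
    (Algebra.TensorProduct.map (σ : A →ₐ[k] A) (AlgHom.op (τ : A →ₐ[k] A))).toRingHom).obj M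

variable (k A)

/-- The underlying left module of a bimodule. -/
abbrev resLeft : ModuleCat.{u} (Env k A) ⥤ ModuleCat.{u} A :=
  ModuleCat.restrictScalars (Algebra.TensorProduct.includeLeft : A →ₐ[k] Env k A).toRingHom

/-- The underlying right module (module over `Aᵒᵖ`) of a bimodule. -/
abbrev resRight : ModuleCat.{u} (Env k A) ⥤ ModuleCat.{u} Aᵐᵒᵖ :=
  ModuleCat.restrictScalars (Algebra.TensorProduct.includeRight : Aᵐᵒᵖ →ₐ[k] Env k A).toRingHom

end Bimodules

/-- If `f : B → E` and `g : C → E` have commuting images, each `c : C` acts on an `E`-module by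
`B`-linear endomorphisms, naturally in the module. -/
def commutingAction {B C E : Type u} [Ring B] [Ring C] [Ring E] (f : B →+* E) (g : C →+* E)
    (h : ∀ b c, f b * g c = g c * f b) (c : C) :
    ModuleCat.restrictScalars.{u} f ⟶ ModuleCat.restrictScalars.{u} f where
  app M := ModuleCat.ofHom (Y := (ModuleCat.restrictScalars f).obj M)
    (X := (ModuleCat.restrictScalars f).obj M)
    { toFun := fun (m : M) => g c • m
      map_add' := fun x y => smul_add (g c) (show M from x) (show M from y)
      map_smul' := fun b x => by
        change (g c • f b • (show M from x) : M) = f b • g c • (show M from x)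
        rw [smul_smul, smul_smul, h] }
  naturality M N φ := by
    ext x
    exact (φ.hom.map_smul (g c) x).symm

section Tensor

variable {k : Type u} [Field k] {B C : Type u} [Ring B] [Algebra k B] [Ring C] [Algebra k C]

/-- The commuting action of `C` on a `B ⊗ C`-module by `B`-linear maps. -/
abbrev actRight (c : C) :
    ModuleCat.restrictScalars.{u}
        (Algebra.TensorProduct.includeLeft : B →ₐ[k] B ⊗[k] C).toRingHom ⟶
      ModuleCat.restrictScalars.{u}
        (Algebra.TensorProduct.includeLeft : B →ₐ[k] B ⊗[k] C).toRingHom :=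
  commutingAction (Algebra.TensorProduct.includeLeft : B →ₐ[k] B ⊗[k] C).toRingHom
    (Algebra.TensorProduct.includeRight : C →ₐ[k] B ⊗[k] C).toRingHom
    (fun b c => by simp) c

/-- The commuting action of `B` on a `B ⊗ C`-module by `C`-linear maps. -/
abbrev actLeft (b : B) :
    ModuleCat.restrictScalars.{u}
        (Algebra.TensorProduct.includeRight : C →ₐ[k] B ⊗[k] C).toRingHom ⟶
      ModuleCat.restrictScalars.{u}
        (Algebra.TensorProduct.includeRight : C →ₐ[k] B ⊗[k] C).toRingHom :=
  commutingAction (Algebra.TensorProduct.includeRight : C →ₐ[k] B ⊗[k] C).toRingHom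
    (Algebra.TensorProduct.includeLeft : B →ₐ[k] B ⊗[k] C).toRingHom
    (fun c b => by simp) b

variable (k C) in
/-- For a `B`-module `X` and a `B ⊗ C`-module `M`, the `C`-module `Hom_B(X, M)`, where `C` acts on
homomorphisms through `M`. -/
def homObj (X : ModuleCat.{u} B) (M : ModuleCat.{u} (B ⊗[k] C)) : ModuleCat.{u} C :=
  letI : Module C (X ⟶ (ModuleCat.restrictScalars
      (Algebra.TensorProduct.includeLeft : B →ₐ[k] B ⊗[k] C).toRingHom).obj M) :=
    { smul := fun c f => f ≫ (actRight c).app M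
      one_smul := fun f => by
        ext x
        exact one_smul (B ⊗[k] C) (show M from f.hom x)
      mul_smul := fun c c' f => by
        ext x
        change (((1 : B) ⊗ₜ[k] (c * c')) • (show M from f.hom x) : M) =
          ((1 : B) ⊗ₜ[k] c) • ((1 : B) ⊗ₜ[k] c') • (show M from f.hom x)
        rw [smul_smul, Algebra.TensorProduct.tmul_mul_tmul, one_mul]
      smul_zero := fun c => Limits.zero_comp
      smul_add := fun c f g => Preadditive.add_comp _ _ _ f g _
      add_smul := fun c c' f => by
        ext x
        change (((1 : B) ⊗ₜ[k] (c + c')) • (show M from f.hom x) : M) =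
          ((1 : B) ⊗ₜ[k] c) • (show M from f.hom x) + ((1 : B) ⊗ₜ[k] c') • (show M from f.hom x)
        rw [TensorProduct.tmul_add, add_smul]
      zero_smul := fun f => by
        ext x
        change (((1 : B) ⊗ₜ[k] (0 : C)) • (show M from f.hom x) : M) = 0
        rw [TensorProduct.tmul_zero, zero_smul] }
  ModuleCat.of C (X ⟶ (ModuleCat.restrictScalars
      (Algebra.TensorProduct.includeLeft : B →ₐ[k] B ⊗[k] C).toRingHom).obj M)

variable (k C) in
/-- The functor `Hom_B(X, -)` from `B ⊗ C`-modules to `C`-modules. -/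
def homFunctor (X : ModuleCat.{u} B) : ModuleCat.{u} (B ⊗[k] C) ⥤ ModuleCat.{u} C where
  obj M := homObj k C X M
  map {M N} φ := ModuleCat.ofHom (X := homObj k C X M) (Y := homObj k C X N)
    { toFun := fun (f : X ⟶ (ModuleCat.restrictScalars
          (Algebra.TensorProduct.includeLeft : B →ₐ[k] B ⊗[k] C).toRingHom).obj M) =>
        f ≫ (ModuleCat.restrictScalars
        (Algebra.TensorProduct.includeLeft : B →ₐ[k] B ⊗[k] C).toRingHom).map φ
      map_add' := fun f g => Preadditive.add_comp _ _ _ f g _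
      map_smul' := fun c f => by
        change ((show X ⟶ _ from f) ≫ (actRight c).app M) ≫ _ =
          ((show X ⟶ _ from f) ≫ _) ≫ (actRight c).app N
        rw [Category.assoc, Category.assoc, (actRight c).naturality φ] }
  map_id M := by
    apply ModuleCat.hom_ext
    apply LinearMap.ext
    intro f
    change (show X ⟶ _ from f) ≫ (ModuleCat.restrictScalars _).map (𝟙 M) = f
    exact Category.comp_id (X := X) _
  map_comp φ ψ := by
    apply ModuleCat.hom_ext
    apply LinearMap.ext
    intro f
    change (show X ⟶ _ from f) ≫ (ModuleCat.restrictScalars _).map (φ ≫ ψ) =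
      ((show X ⟶ _ from f) ≫ (ModuleCat.restrictScalars _).map φ) ≫
        (ModuleCat.restrictScalars _).map ψ
    rw [Functor.map_comp, Category.assoc]

instance (X : ModuleCat.{u} B) : (homFunctor k C X).Additive where
  map_add {M N φ ψ} := by
    apply ModuleCat.hom_ext
    apply LinearMap.ext
    intro f
    change (show X ⟶ _ from f) ≫ (ModuleCat.restrictScalars _).map (φ + ψ) =
      (show X ⟶ _ from f) ≫ (ModuleCat.restrictScalars _).map φ +
        (show X ⟶ _ from f) ≫ (ModuleCat.restrictScalars _).map ψ
    rw [Functor.map_add, Preadditive.comp_add]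

end Tensor


section ExternalTensor

variable {k : Type u} [Field k] {E F : Type u} [Ring E] [Algebra k E] [Ring F] [Algebra k F]

/-- The action of `E ⊗ F` on `M ⊗ N`: `(x ⊗ y) • (m ⊗ n) = x • m ⊗ y • n`. -/
def extTensorAction (M : ModuleCat.{u} E) (N : ModuleCat.{u} F) :
    E ⊗[k] F →ₐ[k] Module.End k (M ⊗[k] N) :=
  (Module.endTensorEndAlgHom (R := k) (S := k) (A := k) (M := M) (N := N)).comp
    (Algebra.TensorProduct.map (Algebra.lsmul k k M) (Algebra.lsmul k k N))

variable (k) in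
/-- The external tensor product `M ⊗ N` over `k`, an `E ⊗ F`-module. -/
def extTensorObj (M : ModuleCat.{u} E) (N : ModuleCat.{u} F) : ModuleCat.{u} (E ⊗[k] F) :=
  letI : Module (E ⊗[k] F) (M ⊗[k] N) :=
    Module.compHom _ (extTensorAction (k := k) M N).toRingHom
  ModuleCat.of (E ⊗[k] F) (M ⊗[k] N)

variable (k) in
/-- Functoriality of the external tensor product. -/
def extTensorMap {M M' : ModuleCat.{u} E} {N N' : ModuleCat.{u} F} (φ : M ⟶ M') (ψ : N ⟶ N') :
    extTensorObj k M N ⟶ extTensorObj k M' N' :=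
  ModuleCat.ofHom (X := extTensorObj k M N) (Y := extTensorObj k M' N')
    { toFun := fun (t : M ⊗[k] N) =>
        TensorProduct.map (φ.hom.restrictScalars k) (ψ.hom.restrictScalars k) t
      map_add' := fun s t => map_add (TensorProduct.map _ _) s t
      map_smul' := fun e t => by
        have key : ∀ (e : E ⊗[k] F) (t : M ⊗[k] N),
            TensorProduct.map (φ.hom.restrictScalars k) (ψ.hom.restrictScalars k)
              (extTensorAction (k := k) M N e t) =
            extTensorAction (k := k) M' N' e
              (TensorProduct.map (φ.hom.restrictScalars k) (ψ.hom.restrictScalars k) t) := by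
          intro e t
          induction e using TensorProduct.induction_on with
          | zero => simp
          | add x y hx hy => simp only [map_add, LinearMap.add_apply, hx, hy]
          | tmul x y =>
            induction t using TensorProduct.induction_on with
            | zero => simp
            | add s t hs ht => simp only [map_add, hs, ht]
            | tmul m n =>
              change (φ.hom (x • m)) ⊗ₜ[k] (ψ.hom (y • n)) = (x • φ.hom m) ⊗ₜ[k] (y • ψ.hom n)
              rw [map_smul, map_smul]
        exact key e t }

variable (k E F) in
/-- The external tensor product as a bifunctor. -/
def extTensor : ModuleCat.{u} E ⥤ ModuleCat.{u} F ⥤ ModuleCat.{u} (E ⊗[k] F) where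
  obj M :=
    { obj := fun N => extTensorObj k M N
      map := fun ψ => extTensorMap k (𝟙 M) ψ
      map_id := fun N => by
        apply ModuleCat.hom_ext
        apply LinearMap.ext
        exact fun t => LinearMap.congr_fun (TensorProduct.map_id (R := k) (M := M) (N := N)) t
      map_comp := fun {N₁ N₂ N₃} ψ ψ' => by
        apply ModuleCat.hom_ext
        apply LinearMap.ext
        intro t
        exact LinearMap.congr_fun (TensorProduct.map_comp (R := k)
          (LinearMap.id (M := M)) (ψ'.hom.restrictScalars k)
          (LinearMap.id (M := M)) (ψ.hom.restrictScalars k)) t }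
  map φ :=
    { app := fun N => extTensorMap k φ (𝟙 N)
      naturality := fun {N N'} ψ => by
        apply ModuleCat.hom_ext
        apply LinearMap.ext
        intro t
        change TensorProduct.map (φ.hom.restrictScalars k) (LinearMap.id (M := N'))
            (TensorProduct.map (LinearMap.id) (ψ.hom.restrictScalars k) t) =
          TensorProduct.map (LinearMap.id) (ψ.hom.restrictScalars k)
            (TensorProduct.map (φ.hom.restrictScalars k) (LinearMap.id (M := N)) t)
        exact (LinearMap.congr_fun (TensorProduct.map_comp (R := k)
            (φ.hom.restrictScalars k) (LinearMap.id (M := N'))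
            (LinearMap.id) (ψ.hom.restrictScalars k)) t).symm.trans
          (LinearMap.congr_fun (TensorProduct.map_comp (R := k)
            (LinearMap.id) (ψ.hom.restrictScalars k)
            (φ.hom.restrictScalars k) (LinearMap.id (M := N))) t) }
  map_id M := by
    ext N : 2
    apply ModuleCat.hom_ext
    apply LinearMap.ext
    exact fun t => LinearMap.congr_fun (TensorProduct.map_id (R := k) (M := M) (N := N)) t
  map_comp {M₁ M₂ M₃} φ φ' := by
    ext N : 2
    apply ModuleCat.hom_ext
    apply LinearMap.ext
    intro t
    exact LinearMap.congr_fun (TensorProduct.map_comp (R := k)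
      (φ'.hom.restrictScalars k) (LinearMap.id (M := N))
      (φ.hom.restrictScalars k) (LinearMap.id (M := N))) t

instance : (extTensor k E F).PreservesZeroMorphisms where
  map_zero M M' := by
    ext N : 2
    apply ModuleCat.hom_ext
    apply LinearMap.ext
    exact fun t => LinearMap.congr_fun
      (TensorProduct.map_zero_left (M₂ := M') (LinearMap.id (M := N))) t

instance (M : ModuleCat.{u} E) : ((extTensor k E F).obj M).PreservesZeroMorphisms where
  map_zero N N' := by
    apply ModuleCat.hom_ext
    apply LinearMap.ext
    exact fun t => LinearMap.congr_fun
      (TensorProduct.map_zero_right (N₂ := N') (LinearMap.id (M := M))) t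

end ExternalTensor

section TensorOp

variable (k A : Type u) [Field k] [Ring A] [Algebra k A]

/-- The automorphism `(a ⊗ op b) ⊗ (b' ⊗ op c) ↦ (a ⊗ op c) ⊗ (b' ⊗ op b)` of `Aᵉ ⊗ Aᵉ`. -/
def swapOp : Env k A ⊗[k] Env k A ≃ₐ[k] Env k A ⊗[k] Env k A :=
  ((Algebra.TensorProduct.congr AlgEquiv.refl (Algebra.TensorProduct.comm k A Aᵐᵒᵖ)).trans
    (Algebra.TensorProduct.tensorTensorTensorComm k k k k A Aᵐᵒᵖ Aᵐᵒᵖ A)).trans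
    (Algebra.TensorProduct.congr AlgEquiv.refl (Algebra.TensorProduct.comm k Aᵐᵒᵖ A))

theorem swapOp_tmul (a b b' c : A) :
    swapOp k A ((a ⊗ₜ op b) ⊗ₜ (b' ⊗ₜ op c)) = (a ⊗ₜ op c) ⊗ₜ (b' ⊗ₜ op b) := rfl

/-- For a complex `R` of `A`-bimodules, the complex `R ⊗ Rᵒᵖ` (tensor product over `k`). -/
def tensorOp (R : CochainComplex (ModuleCat.{u} (Env k A)) ℤ) :
    CochainComplex (ModuleCat.{u} (Env k A ⊗[k] Env k A)) ℤ :=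
  ((ModuleCat.restrictScalars (swapOp k A : _ →ₐ[k] _).toRingHom).mapHomologicalComplex
    (ComplexShape.up ℤ)).obj
    (HomologicalComplex.mapBifunctor R R (extTensor k (Env k A) (Env k A)) (ComplexShape.up ℤ))

theorem tensorOp_plus (R : CochainComplex (ModuleCat.{u} (Env k A)) ℤ)
    (hR : CochainComplex.plus _ R) : CochainComplex.plus _ (tensorOp k A R) := by
  obtain ⟨n, hn⟩ := hR
  have h : CochainComplex.IsStrictlyGE (HomologicalComplex.mapBifunctor R R
      (extTensor k (Env k A) (Env k A)) (ComplexShape.up ℤ)) (n + n) := by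
    rw [CochainComplex.isStrictlyGE_iff]
    intro i hi
    rw [Limits.IsZero.iff_id_eq_zero]
    apply HomologicalComplex.mapBifunctor.hom_ext
    intro i₁ i₂ h
    have h' : i₁ + i₂ = i := h
    have hz : Limits.IsZero
        (((extTensor k (Env k A) (Env k A)).obj (R.X i₁)).obj (R.X i₂)) := by
      by_cases h₁ : i₁ < n
      · have := (extTensor k (Env k A) (Env k A)).map_isZero
          (CochainComplex.isZero_of_isStrictlyGE R n i₁ h₁)
        exact this.obj _
      · exact ((extTensor k (Env k A) (Env k A)).obj (R.X i₁)).map_isZero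
          (CochainComplex.isZero_of_isStrictlyGE R n i₂ (by omega))
    exact hz.eq_of_src _ _
  refine ⟨n + n, ?_⟩
  dsimp only [tensorOp]
  infer_instance

end TensorOp

/-! ## Derived notions -/

section Derived

attribute [local instance] HasDerivedCategory.standard

variable {k : Type u} [Field k] {B C : Type u} [Ring B] [Algebra k B] [Ring C] [Algebra k C]

variable (k C) in
/-- The object `RHom_B(X, M)` of `D(C-Mod)`, for a `B`-module `X` and a bounded below complex `M`
of `B ⊗ C`-modules: the right derived functor of `Hom_B(X, -)` evaluated at `M`. (As `k` is a
field, injective `B ⊗ C`-modules are injective over `B`.) -/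
def rHom (X : ModuleCat.{u} B) (M : CochainComplex.Plus (ModuleCat.{u} (B ⊗[k] C))) :
    DerivedCategory (ModuleCat.{u} C) :=
  DerivedCategory.Plus.ι.obj
    ((homFunctor k C X).rightDerivedFunctorPlus.obj (DerivedCategory.Plus.Q.obj M))

/-- A complex of modules has finite injective dimension if it is isomorphic, in the derived
category, to a bounded complex of injective modules. -/
def HasFiniteInjDim (X : CochainComplex (ModuleCat.{u} B) ℤ) : Prop :=
  ∃ I : CochainComplex (ModuleCat.{u} B) ℤ,
    (∃ a b : ℤ, I.IsStrictlyGE a ∧ I.IsStrictlyLE b) ∧ (∀ n, Injective (I.X n)) ∧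
      Nonempty (DerivedCategory.Q.obj X ≅ DerivedCategory.Q.obj I)

/-- A complex is homologically finite if the direct sum of its cohomology modules is a finitely
generated module. -/
def HomologicallyFinite (X : CochainComplex (ModuleCat.{u} B) ℤ) : Prop :=
  Module.Finite B (DirectSum ℤ fun i => X.homology i)

variable (k : Type u) [Field k] (A : Type u) [Ring A] [Algebra k A]

/-- The complex of left modules underlying a complex of bimodules. -/
abbrev cpxLeft (R : CochainComplex (ModuleCat.{u} (Env k A)) ℤ) :
    CochainComplex (ModuleCat.{u} A) ℤ :=
  ((resLeft k A).mapHomologicalComplex (ComplexShape.up ℤ)).obj R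

/-- The complex of right modules underlying a complex of bimodules. -/
abbrev cpxRight (R : CochainComplex (ModuleCat.{u} (Env k A)) ℤ) :
    CochainComplex (ModuleCat.{u} Aᵐᵒᵖ) ℤ :=
  ((resRight k A).mapHomologicalComplex (ComplexShape.up ℤ)).obj R

/-- Right multiplication by `a` on a complex of bimodules, as an endomorphism of the underlying
complex of left modules. -/
def rightMulCpx (R : CochainComplex (ModuleCat.{u} (Env k A)) ℤ) (a : A) :
    cpxLeft k A R ⟶ cpxLeft k A R :=
  (NatTrans.mapHomologicalComplex (actRight (k := k) (B := A) (op a)) (ComplexShape.up ℤ)).app R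

/-- Left multiplication by `a` on a complex of bimodules, as an endomorphism of the underlying
complex of right modules. -/
def leftMulCpx (R : CochainComplex (ModuleCat.{u} (Env k A)) ℤ) (a : A) :
    cpxRight k A R ⟶ cpxRight k A R :=
  (NatTrans.mapHomologicalComplex (actLeft (k := k) (C := Aᵐᵒᵖ) a) (ComplexShape.up ℤ)).app R

/-- Dualising complexes over `A`, represented by bounded complexes of bimodules.

The canonical morphism `A → RHom_A(R, R)` is an isomorphism in the derived category if and only if
it is bijective on cohomology. As `Hⁿ(RHom_A(R, R)) = Hom_{D(A)}(R, R[n])`, this means that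
`Hom_{D(A)}(R, R[n]) = 0` for `n ≠ 0` and that right multiplication gives a bijection
`A → End_{D(A)}(R)`; likewise on the other side. -/
structure IsDualisingComplex (R : CochainComplex (ModuleCat.{u} (Env k A)) ℤ) : Prop where
  bounded : ∃ a b : ℤ, R.IsStrictlyGE a ∧ R.IsStrictlyLE b
  injDim_left : HasFiniteInjDim (cpxLeft k A R)
  injDim_right : HasFiniteInjDim (cpxRight k A R)
  finite_left : HomologicallyFinite (cpxLeft k A R)
  finite_right : HomologicallyFinite (cpxRight k A R)
  hom_shift_left : ∀ n : ℤ, n ≠ 0 → Subsingleton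
    (DerivedCategory.Q.obj (cpxLeft k A R) ⟶ (DerivedCategory.Q.obj (cpxLeft k A R))⟦n⟧)
  end_left : Function.Bijective fun a : A => DerivedCategory.Q.map (rightMulCpx k A R a)
  hom_shift_right : ∀ n : ℤ, n ≠ 0 → Subsingleton
    (DerivedCategory.Q.obj (cpxRight k A R) ⟶ (DerivedCategory.Q.obj (cpxRight k A R))⟦n⟧)
  end_right : Function.Bijective fun a : A => DerivedCategory.Q.map (leftMulCpx k A R a)

variable {k A} in
theorem IsDualisingComplex.plus_tensorOp {R : CochainComplex (ModuleCat.{u} (Env k A)) ℤ}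
    (hR : IsDualisingComplex k A R) : CochainComplex.plus _ (tensorOp k A R) :=
  tensorOp_plus k A R (by obtain ⟨a, _, h, _⟩ := hR.bounded; exact ⟨a, h⟩)

/-- A rigid dualising complex: a dualising complex `R` with `R ≅ RHom_{Aᵉ}(A, R ⊗ Rᵒᵖ)` in
`D(Aᵉ-Mod)`. -/
structure IsRigidDualisingComplex (R : CochainComplex (ModuleCat.{u} (Env k A)) ℤ) : Prop where
  dualising : IsDualisingComplex k A R
  rigid : Nonempty (DerivedCategory.Q.obj R ≅
    rHom k (Env k A) (regularBimodule k A) ⟨tensorOp k A R, dualising.plus_tensorOp⟩)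

end Derived

/-! ## Ext modules -/

section Ext

theorem mk₀_smul_hom {k B : Type u} [Field k] [Ring B] [Algebra k B] {Y Z : ModuleCat.{u} B}
    (f g : Y ⟶ Z) (r : k) (h : ∀ y, g.hom y = algebraMap k B r • f.hom y) :
    Abelian.Ext.mk₀ g = r • Abelian.Ext.mk₀ f := by
  have h' : g = r • f := by
    ext y
    exact h y
  rw [h']
  exact Abelian.Ext.mk₀_smul r f

/-- The group `Ext^i_B(X, B)`. -/
def ExtRing {B : Type u} [Ring B] (X : ModuleCat.{u} B) (i : ℕ) : Type u :=
  Abelian.Ext.{u} X (ModuleCat.of B B) i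

section
variable {B : Type u} [Ring B] (X : ModuleCat.{u} B) (i : ℕ)

instance : AddCommGroup (ExtRing X i) :=
  inferInstanceAs (AddCommGroup (Abelian.Ext.{u} X (ModuleCat.of B B) i))

instance {k : Type u} [Field k] [Algebra k B] : Module k (ExtRing X i) :=
  inferInstanceAs (Module k (Abelian.Ext.{u} X (ModuleCat.of B B) i))

/-- Right multiplication by `b` on `B`, as a morphism of left modules. -/
def rightMul (b : B) : ModuleCat.of B B ⟶ ModuleCat.of B B :=
  ModuleCat.ofHom (LinearMap.toSpanSingleton B B b)

variable {X i} in
/-- Right multiplication by `b` on `Ext^i_B(X, B)`, induced by right multiplication on `B`. -/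
def extMul (x : Abelian.Ext.{u} X (ModuleCat.of B B) i) (b : B) :
    Abelian.Ext.{u} X (ModuleCat.of B B) i :=
  x.comp (Abelian.Ext.mk₀ (rightMul b)) (add_zero i)

section
variable (x y : Abelian.Ext.{u} X (ModuleCat.of B B) i) (b c : B)

theorem extMul_one : extMul x (1 : B) = x := by
  have : rightMul (1 : B) = 𝟙 _ := by ext; simp [rightMul]
  rw [extMul, this, Abelian.Ext.comp_mk₀_id]

theorem extMul_mul : extMul x (b * c) = extMul (extMul x b) c := by
  have : rightMul (b * c) = rightMul b ≫ rightMul c := by ext; simp [rightMul]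
  rw [extMul, extMul, extMul, this, Abelian.Ext.comp_assoc_of_third_deg_zero,
    Abelian.Ext.mk₀_comp_mk₀]

theorem extMul_add : extMul x (b + c) = extMul x b + extMul x c := by
  have : rightMul (b + c) = rightMul b + rightMul c := by ext; simp [rightMul]
  rw [extMul, extMul, extMul, this, Abelian.Ext.mk₀_add, Abelian.Ext.comp_add]

theorem extMul_zero : extMul x (0 : B) = 0 := by
  have : rightMul (0 : B) = 0 := by ext; simp [rightMul]
  rw [extMul, this, Abelian.Ext.mk₀_zero, Abelian.Ext.comp_zero]

theorem add_extMul : extMul (x + y) b = extMul x b + extMul y b :=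
  Abelian.Ext.add_comp _ _ _ _

theorem zero_extMul : extMul (0 : Abelian.Ext.{u} X (ModuleCat.of B B) i) b = 0 := by
  rw [extMul, Abelian.Ext.zero_comp]

theorem extMul_smul {k : Type u} [Field k] [Algebra k B] (r : k) :
    extMul x (r • b) = r • extMul x b := by
  have h : Abelian.Ext.mk₀ (rightMul (r • b)) = r • Abelian.Ext.mk₀ (rightMul b) :=
    mk₀_smul_hom _ _ r fun y => by
      change y * (r • b) = algebraMap k B r * (y * b)
      rw [mul_smul_comm, Algebra.smul_def]
  rw [extMul, extMul, h, Abelian.Ext.comp_smul]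

end

/-- `Ext^i_B(X, B)` as a right `B`-module. -/
instance : Module Bᵐᵒᵖ (ExtRing X i) where
  smul b x := extMul (B := B) (X := X) (i := i) x b.unop
  one_smul x := extMul_one X i x
  mul_smul b c x := extMul_mul X i x c.unop b.unop
  smul_zero b := zero_extMul X i b.unop
  smul_add b x y := add_extMul X i x y b.unop
  add_smul b c x := extMul_add X i x b.unop c.unop
  zero_smul x := extMul_zero X i x

instance {k : Type u} [Field k] [Algebra k B] : IsScalarTower k Bᵐᵒᵖ (ExtRing X i) where
  smul_assoc r b x := extMul_smul X i x b.unop r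

end

variable (k A : Type u) [Field k] [Ring A] [Algebra k A]

/-- The algebra isomorphism `Aᵉ → (Aᵉ)ᵒᵖ`, `a ⊗ op b ↦ op (b ⊗ op a)`. -/
def envFlip : Env k A ≃ₐ[k] (Env k A)ᵐᵒᵖ :=
  ((Algebra.TensorProduct.comm k A Aᵐᵒᵖ).trans
    (Algebra.TensorProduct.congr AlgEquiv.refl (AlgEquiv.opOp k A))).trans
    (Algebra.TensorProduct.opAlgEquiv k k A Aᵐᵒᵖ)

theorem envFlip_tmul (a b : A) :
    envFlip k A (a ⊗ₜ op b) = op (b ⊗ₜ op a) := by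
  simp [envFlip]

/-- The `A`-bimodule `Ext^i_{Aᵉ}(A, Aᵉ)`: its structure is the one induced by the right
`Aᵉ`-module structure of the target `Aᵉ`, that is, by `b · (x ⊗ op y) · c = x c ⊗ op (b y)`. -/
def hochschildExt (i : ℕ) : ModuleCat.{u} (Env k A) :=
  (ModuleCat.restrictScalars (envFlip k A : Env k A →ₐ[k] _).toRingHom).obj
    (ModuleCat.of (Env k A)ᵐᵒᵖ (ExtRing (regularBimodule k A) i))

section
variable {k A} {P : ModuleCat.{u} (Env k A)} {i : ℕ}

/-- Left multiplication by `a` on `Ext^i_A(P, A)` for a bimodule `P`, induced by right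
multiplication by `a` on `P`. -/
def mulExt (a : A) (x : Abelian.Ext.{u} ((resLeft k A).obj P) (ModuleCat.of A A) i) :
    Abelian.Ext.{u} ((resLeft k A).obj P) (ModuleCat.of A A) i :=
  (Abelian.Ext.mk₀ ((actRight (k := k) (B := A) (op a)).app P)).comp x (zero_add i)

variable (x y : Abelian.Ext.{u} ((resLeft k A).obj P) (ModuleCat.of A A) i) (a b : A)

theorem one_mulExt : mulExt (1 : A) x = x := by
  have : (actRight (k := k) (B := A) (op (1 : A))).app P = 𝟙 _ := by
    ext p
    exact one_smul (Env k A) (show P from p)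
  rw [mulExt, this, Abelian.Ext.mk₀_id_comp]

theorem mul_mulExt : mulExt (a * b) x = mulExt a (mulExt b x) := by
  have : (actRight (k := k) (B := A) (op (a * b))).app P =
      (actRight (k := k) (B := A) (op a)).app P ≫ (actRight (k := k) (B := A) (op b)).app P := by
    have key : ∀ p : P, envR k (a * b) • p = envR k b • envR k a • p := fun p => by
      rw [smul_smul, Algebra.TensorProduct.tmul_mul_tmul, one_mul, ← MulOpposite.op_mul]
    ext p
    exact key p
  rw [mulExt, mulExt, mulExt, this, Abelian.Ext.mk₀_comp_mk₀_assoc]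

theorem add_mulExt : mulExt (a + b) x = mulExt a x + mulExt b x := by
  have : (actRight (k := k) (B := A) (op (a + b))).app P =
      (actRight (k := k) (B := A) (op a)).app P + (actRight (k := k) (B := A) (op b)).app P := by
    have key : ∀ p : P, envR k (a + b) • p = envR k a • p + envR k b • p := fun p => by
      rw [envR, MulOpposite.op_add, TensorProduct.tmul_add, add_smul]
    ext p
    exact key p
  rw [mulExt, mulExt, mulExt, this, Abelian.Ext.mk₀_add, Abelian.Ext.add_comp]

theorem zero_mulExt : mulExt (0 : A) x = 0 := by
  have : (actRight (k := k) (B := A) (op (0 : A))).app P = 0 := by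
    have key : ∀ p : P, envR k (0 : A) • p = 0 := fun p => by
      rw [envR, MulOpposite.op_zero, TensorProduct.tmul_zero]
      exact zero_smul (Env k A) p
    ext p
    exact key p
  rw [mulExt, this, Abelian.Ext.mk₀_zero, Abelian.Ext.zero_comp]

theorem mulExt_add : mulExt a (x + y) = mulExt a x + mulExt a y :=
  Abelian.Ext.comp_add _ _ _ _

theorem mulExt_zero :
    mulExt a (0 : Abelian.Ext.{u} ((resLeft k A).obj P) (ModuleCat.of A A) i) = 0 :=
  Abelian.Ext.comp_zero _ _ _ _ _

theorem smul_mulExt (r : k) : mulExt (r • a) x = r • mulExt a x := by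
  have key : ∀ p : P, envR k (r • a) • p = envL k (algebraMap k A r) • envR k a • p :=
    fun p => by
      rw [smul_smul, Algebra.TensorProduct.tmul_mul_tmul, one_mul, mul_one, envR,
        MulOpposite.op_smul, ← TensorProduct.smul_tmul, Algebra.algebraMap_eq_smul_one]
  have h : Abelian.Ext.mk₀ ((actRight (k := k) (B := A) (op (r • a))).app P) =
      r • Abelian.Ext.mk₀ ((actRight (k := k) (B := A) (op a)).app P) :=
    mk₀_smul_hom _ _ r key
  rw [mulExt, mulExt, h, Abelian.Ext.smul_comp]

theorem mulExt_extMul : mulExt a (extMul x b) = extMul (mulExt a x) b :=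
  (Abelian.Ext.comp_assoc_of_third_deg_zero _ _ _ _).symm

end

/-- For an `A`-bimodule `P`, the `A`-bimodule `Ext^i_A(P, A)` (Ext of left modules); the left
structure comes from the right structure of `P`, the right structure from the right structure of
the target `A`. -/
def extBimodule (P : ModuleCat.{u} (Env k A)) (i : ℕ) : ModuleCat.{u} (Env k A) :=
  letI : Module A (ExtRing ((resLeft k A).obj P) i) :=
    { smul := fun a x => mulExt (P := P) (i := i) a x
      one_smul := fun x => one_mulExt (P := P) (i := i) x
      mul_smul := fun a b x => mul_mulExt (P := P) (i := i) x a b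
      smul_zero := fun a => mulExt_zero (P := P) (i := i) a
      smul_add := fun a x y => mulExt_add (P := P) (i := i) x y a
      add_smul := fun a b x => add_mulExt (P := P) (i := i) x a b
      zero_smul := fun x => zero_mulExt (P := P) (i := i) x }
  haveI : IsScalarTower k A (ExtRing ((resLeft k A).obj P) i) :=
    ⟨fun r a x => smul_mulExt (P := P) (i := i) x a r⟩
  haveI : SMulCommClass A Aᵐᵒᵖ (ExtRing ((resLeft k A).obj P) i) :=
    ⟨fun a b x => mulExt_extMul (P := P) (i := i) x a b.unop⟩
  letI : Module (Env k A) (ExtRing ((resLeft k A).obj P) i) := TensorProduct.Algebra.module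
  ModuleCat.of (Env k A) (ExtRing ((resLeft k A).obj P) i)

end Ext

/-! ## AS-Gorenstein algebras, integrals -/

section Gorenstein

variable (k A : Type u) [Field k] [Ring A] [Algebra k A]

/-- `A` has (left and right) injective dimension `d`. -/
def HasInjDim (d : ℕ) : Prop :=
  injectiveDimension (ModuleCat.of A A) = d ∧ injectiveDimension (ModuleCat.of Aᵐᵒᵖ Aᵐᵒᵖ) = d

/-- A `k`-algebra `A` with augmentation `ε` is AS-Gorenstein of injective dimension `d`. -/
structure IsASGorenstein (ε : A →ₐ[k] k) (d : ℕ) : Prop where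
  injDim_left : injectiveDimension (ModuleCat.of A A) = d
  finrank_left : Module.finrank k (ExtRing ((resLeft k A).obj (trivialBimodule ε)) d) = 1
  vanish_left : ∀ i, i ≠ d → Subsingleton (ExtRing ((resLeft k A).obj (trivialBimodule ε)) i)
  injDim_right : injectiveDimension (ModuleCat.of Aᵐᵒᵖ Aᵐᵒᵖ) = d
  finrank_right : Module.finrank k (ExtRing ((resRight k A).obj (trivialBimodule ε)) d) = 1
  vanish_right : ∀ i, i ≠ d → Subsingleton (ExtRing ((resRight k A).obj (trivialBimodule ε)) i)

variable {k A}

/-- The left homological integral `Ext^d_A(k, A)`, as an `A`-bimodule. -/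
def leftIntegral (ε : A →ₐ[k] k) (d : ℕ) : ModuleCat.{u} (Env k A) :=
  extBimodule k A (trivialBimodule ε) d

theorem existsUnique_character {M : Type u} [AddCommGroup M] [Module k M] [Module Aᵐᵒᵖ M]
    [IsScalarTower k Aᵐᵒᵖ M] (hM : Module.finrank k M = 1) :
    ∃! π : A →ₐ[k] k, ∀ a, π a = 0 ↔ ∀ x : M, op a • x = 0 := by
  obtain ⟨v, hv, hs⟩ := finrank_eq_one_iff'.1 hM
  have hcomm : ∀ (b : Aᵐᵒᵖ) (r : k) (x : M), b • r • x = r • b • x := fun b r x => by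
    rw [← algebraMap_smul Aᵐᵒᵖ r x, ← algebraMap_smul Aᵐᵒᵖ r (b • x), smul_smul, smul_smul,
      Algebra.commutes]
  choose c hc using fun a : A => hs (op a • v)
  have inj : ∀ r s : k, r • v = s • v → r = s := fun r s h => smul_left_injective k hv h
  have hall : ∀ a (x : M), op a • x = c a • x := fun a x => by
    obtain ⟨r, rfl⟩ := hs x
    rw [hcomm, ← hc, smul_comm]
  let π : A →ₐ[k] k := AlgHom.ofLinearMap
    { toFun := c
      map_add' := fun a b => inj _ _ (by rw [hc, MulOpposite.op_add, add_smul, add_smul, hc, hc])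
      map_smul' := fun r a => inj _ _ (by
        rw [hc, MulOpposite.op_smul, smul_assoc, ← hc, smul_smul]; rfl) }
    (inj _ _ (by
      change c 1 • v = _
      rw [hc, MulOpposite.op_one, one_smul, one_smul]))
    (fun a b => inj _ _ (by
      change c (a * b) • v = (c a * c b) • v
      rw [hc, MulOpposite.op_mul, mul_smul, ← hc a, hcomm, ← hc b, smul_smul]))
  refine ⟨π, fun a => ⟨fun h x => ?_, fun h => inj _ _ ?_⟩, fun ρ hρ => ?_⟩
  · rw [hall]
    change π a • x = 0
    rw [h, zero_smul]
  · rw [zero_smul]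
    exact (hc a).trans (h v)
  · ext a
    have h1 : ρ (a - algebraMap k A (π a)) = 0 := by
      rw [hρ]
      intro x
      rw [hall]
      change π (a - algebraMap k A (π a)) • x = 0
      rw [map_sub, AlgHom.commutes, Algebra.algebraMap_self_apply, sub_self, zero_smul]
    rw [map_sub, AlgHom.commutes, sub_eq_zero] at h1
    exact h1

/-- The canonical map `π₀ : A → A / r.ann(∫ˡ) = k`: the unique algebra map whose kernel is the
right annihilator of the left integral. -/
def integralCharacter {ε : A →ₐ[k] k} {d : ℕ} (h : IsASGorenstein k A ε d) : A →ₐ[k] k :=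
  (existsUnique_character (A := A) h.finrank_left).choose

theorem integralCharacter_eq_zero_iff {ε : A →ₐ[k] k} {d : ℕ} (h : IsASGorenstein k A ε d)
    (a : A) : integralCharacter h a = 0 ↔ ∀ x : leftIntegral ε d, envR k a • x = 0 := by
  have key : ∀ x : ExtRing ((resLeft k A).obj (trivialBimodule ε)) d,
      (show leftIntegral ε d from op a • x) = envR k a • (show leftIntegral ε d from x) :=
    fun x => (one_mulExt (P := trivialBimodule ε) (i := d) _).symm
  exact ((existsUnique_character (A := A) h.finrank_left).choose_spec.1 a).trans
    ⟨fun H x => (key x).symm.trans (H x), fun H x => (key x).trans (H x)⟩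

variable (k A) in
/-- `A` is rigid Gorenstein of injective dimension `d` with Nakayama automorphism `ν`:
`Ext^i_{Aᵉ}(A, Aᵉ)` vanishes for `i ≠ d` and is isomorphic, as a bimodule, to `^1 A ^ν` for
`i = d`. -/
structure IsRigidGorenstein (d : ℕ) (ν : A ≃ₐ[k] A) : Prop where
  injDim : HasInjDim A d
  vanish : ∀ i, i ≠ d → Subsingleton (hochschildExt k A i)
  iso : Nonempty (hochschildExt k A d ≅ twist AlgEquiv.refl ν (regularBimodule k A))

end Gorenstein

/-! ## Hopf algebras -/

section Hopf

variable {k A : Type u} [Field k] [Ring A] [HopfAlgebra k A]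

/-- The algebra map `a ↦ ∑ π(a₁) a₂`. -/
def leftWindingHom (π : A →ₐ[k] k) : A →ₐ[k] A :=
  ((Algebra.TensorProduct.lid k A : k ⊗[k] A →ₐ[k] A).comp
    (Algebra.TensorProduct.map π (AlgHom.id k A))).comp (Bialgebra.comulAlgHom k A)

theorem leftWindingHom_eq (π : A →ₐ[k] k) (a : A) :
    leftWindingHom π a = TensorProduct.lid k A
      (TensorProduct.map π.toLinearMap LinearMap.id (Coalgebra.comul (R := k) a)) := rfl

theorem leftWindingHom_apply (π : A →ₐ[k] k) (a : A) (r : Coalgebra.Repr k a (A ⊗[k] A)) :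
    leftWindingHom π a = ∑ i ∈ r.index, π (r.left i) • r.right i := by
  rw [leftWindingHom_eq, ← r.eq]
  simp

theorem leftWindingHom_comp (π φ : A →ₐ[k] k) (a : A) :
    leftWindingHom π (leftWindingHom φ a) = TensorProduct.lid k A (TensorProduct.map
      (LinearMap.mul' k k ∘ₗ TensorProduct.map φ.toLinearMap π.toLinearMap ∘ₗ Coalgebra.comul)
      LinearMap.id (Coalgebra.comul (R := k) a)) := by
  let Φ : A ⊗[k] (A ⊗[k] A) →ₗ[k] A := (TensorProduct.lid k A).toLinearMap ∘ₗ
    TensorProduct.map φ.toLinearMap ((TensorProduct.lid k A).toLinearMap ∘ₗ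
      TensorProduct.map π.toLinearMap LinearMap.id)
  have h1 : ∀ t : A ⊗[k] A, leftWindingHom π (TensorProduct.lid k A
      (TensorProduct.map φ.toLinearMap LinearMap.id t)) =
      Φ (Coalgebra.comul.lTensor A t) := by
    intro t
    induction t using TensorProduct.induction_on with
    | zero => simp
    | add x y hx hy => simp only [map_add, hx, hy]
    | tmul x y => simp [Φ, leftWindingHom_eq]
  have h2 : ∀ t : (A ⊗[k] A) ⊗[k] A, Φ (TensorProduct.assoc k A A A t) =
      TensorProduct.lid k A (TensorProduct.map
        (LinearMap.mul' k k ∘ₗ TensorProduct.map φ.toLinearMap π.toLinearMap) LinearMap.id t) := by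
    have : Φ ∘ₗ (TensorProduct.assoc k A A A).toLinearMap = (TensorProduct.lid k A).toLinearMap ∘ₗ
        TensorProduct.map
          (LinearMap.mul' k k ∘ₗ TensorProduct.map φ.toLinearMap π.toLinearMap) LinearMap.id := by
      ext x y z
      simpa [Φ, mul_smul] using smul_comm (π y) (φ x) z
    exact fun t => LinearMap.congr_fun this t
  rw [leftWindingHom_eq φ, h1, ← Coalgebra.coassoc_apply, h2]
  congr 1
  rw [← LinearMap.comp_apply, LinearMap.rTensor, ← TensorProduct.map_comp]
  rfl

/-- The composite of an algebra map `π : A → k` with the antipode. -/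
def characterInv (π : A →ₐ[k] k) : A →ₐ[k] k :=
  AlgHom.ofLinearMap (π.toLinearMap ∘ₗ HopfAlgebra.antipode k)
    (by simp) (fun a b => by simp [HopfAlgebra.antipode_mul_antidistrib, mul_comm])

theorem characterInv_apply (π : A →ₐ[k] k) (a : A) :
    characterInv π a = π (HopfAlgebra.antipode k a) := rfl

theorem conv_characterInv (π : A →ₐ[k] k) :
    LinearMap.mul' k k ∘ₗ TensorProduct.map π.toLinearMap (characterInv π).toLinearMap ∘ₗ
      Coalgebra.comul = Coalgebra.counit := by
  have h : LinearMap.mul' k k ∘ₗ TensorProduct.map π.toLinearMap (characterInv π).toLinearMap =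
      π.toLinearMap ∘ₗ LinearMap.mul' k A ∘ₗ (HopfAlgebra.antipode k).lTensor A := by
    ext x y
    simp [characterInv_apply]
  rw [← LinearMap.comp_assoc, h, LinearMap.comp_assoc, LinearMap.comp_assoc,
    HopfAlgebra.mul_antipode_lTensor_comul]
  ext x
  simp

theorem characterInv_conv (π : A →ₐ[k] k) :
    LinearMap.mul' k k ∘ₗ TensorProduct.map (characterInv π).toLinearMap π.toLinearMap ∘ₗ
      Coalgebra.comul = Coalgebra.counit := by
  have h : LinearMap.mul' k k ∘ₗ TensorProduct.map (characterInv π).toLinearMap π.toLinearMap =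
      π.toLinearMap ∘ₗ LinearMap.mul' k A ∘ₗ (HopfAlgebra.antipode k).rTensor A := by
    ext x y
    simp [characterInv_apply]
  rw [← LinearMap.comp_assoc, h, LinearMap.comp_assoc, LinearMap.comp_assoc,
    HopfAlgebra.mul_antipode_rTensor_comul]
  ext x
  simp

theorem lid_counit (a : A) : TensorProduct.lid k A (TensorProduct.map
    (Coalgebra.counit (R := k)) LinearMap.id (Coalgebra.comul (R := k) a)) = a := by
  have := Coalgebra.rTensor_counit_comul (R := k) a
  rw [LinearMap.rTensor] at this
  rw [this]
  simp

/-- The left winding automorphism `a ↦ ∑ π(a₁) a₂` of an algebra map `π : A → k`. -/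
def leftWinding (π : A →ₐ[k] k) : A ≃ₐ[k] A :=
  AlgEquiv.ofAlgHom (leftWindingHom π) (leftWindingHom (characterInv π))
    (by
      ext a
      rw [AlgHom.comp_apply, leftWindingHom_comp, characterInv_conv, lid_counit]
      rfl)
    (by
      ext a
      rw [AlgHom.comp_apply, leftWindingHom_comp, conv_characterInv, lid_counit]
      rfl)

/-- The winding automorphism `ξ = Ξ[π₀]` associated to the left integral. -/
def integralWinding {d : ℕ} (h : IsASGorenstein k A (Bialgebra.counitAlgHom k A) d) : A ≃ₐ[k] A :=
  leftWinding (integralCharacter h)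

/-- The square of a bijective antipode, as an algebra automorphism. -/
def antipodeSq (hS : Function.Bijective (HopfAlgebra.antipode k (A := A))) : A ≃ₐ[k] A :=
  AlgEquiv.ofBijective
    (AlgHom.ofLinearMap (HopfAlgebra.antipode k ∘ₗ HopfAlgebra.antipode k)
      (by simp) (fun a b => by simp [HopfAlgebra.antipode_mul_antidistrib]))
    (hS.comp hS)

theorem antipodeSq_apply (hS : Function.Bijective (HopfAlgebra.antipode k (A := A))) (a : A) :
    antipodeSq hS a = HopfAlgebra.antipode k (HopfAlgebra.antipode k a) := rfl

/-- The automorphism `ν = ξ S²`, `a ↦ ξ (S (S a))`. -/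
def nakayamaAut (hS : Function.Bijective (HopfAlgebra.antipode k (A := A))) {d : ℕ}
    (h : IsASGorenstein k A (Bialgebra.counitAlgHom k A) d) : A ≃ₐ[k] A :=
  (antipodeSq hS).trans (integralWinding h)

end Hopf
end HopfDuality

end

/-! Hochschild cohomology of a Hopf algebra is an `Ext` group over the algebra itself. Write δ =
`diag` : A → Aᵉ, δ(a) = ∑ a₁ ⊗ op (S a₂), and ad M for a bimodule M restricted along δ. An element m
of M satisfies am = ma for all a exactly when δ(a)m = ε(a)m for all a, so Hom_{Aᵉ}(A, M) = Hom_A(k,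
ad M) (`adjointUnit_bijective`). As Aᵉ is free as a right A-module along δ, ad preserves injectives,
and dimension shifting extends this to Extⁱ_{Aᵉ}(A, M) ≅ Extⁱ_A(k, ad M) (`extTransfer_bijective`).

For M = Aᵉ, the left A-module ad Aᵉ is free on the elements 1 ⊗ op bₛ, with (bₛ) a k-basis of A.
Since k is finitely generated and A is noetherian, Ext_A(k, -) commutes with this direct sum. The
AS-Gorenstein hypothesis therefore gives vanishing outside degree d, and for a generator e of the
left integral every class in degree d is the image of e under x ↦ δ(x)(1 ⊗ op y) for a unique y in
A. Both freeness statements come from convolution: x ⊗ w ↦ ∑ x₁ ⊗ f(x₂)w is bijective once f is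
convolution invertible. The antipode is inverted by the identity when it takes values in A and by S²
when it takes values in Aᵒᵖ; the latter is the source of S² in ν.

Right multiplication by c ⊗ op b sends 1 ⊗ op y to c ⊗ op (by) = ∑ δ(c₁)(1 ⊗ op (b y S²c₂)), and c₁
acts on e by the scalar π₀(c₁). So y is replaced by b y ∑ π₀(c₁)S²c₂ = b y ξ(S²c)
(`adjointClass_comp_rightMul`, `leftWindingHom_antipode_antipode`), which is (a).

For (b), ^νA^1 is free of rank one on either side. Projectivity makes its derived endomorphisms the
ordinary ones, and finite injective dimension is inherited from A. For rigidity, R ⊗ Rᵒᵖ is Aᵉ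
placed in degree -2d, with its inner bimodule structure given by right multiplications twisted by ν
and ν⁻¹. By the computation above RHom from A has cohomology only in degree -2d + d = -d, where the
twists combine to ^νA^1; a complex with cohomology in a single degree is determined by that
cohomology.

For (c), A acts on the integral by ε on the left and by π₀ = ε ∘ ξ = ε ∘ ν on the right. -/

noncomputable section

namespace HopfDuality

/-! ## Convolution and translation maps -/

section Convolution

open WithConv LinearMap Coalgebra

variable {k A : Type u} [Field k] [Ring A] [HopfAlgebra k A]

section Translation

variable {W : Type u} [Ring W] [Algebra k W]

/-- The convolution product of `a ↦ a ⊗ 1` and `a ↦ 1 ⊗ f a`, that is, `a ↦ ∑ a₁ ⊗ f a₂`. -/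
def graph (f : A →ₗ[k] W) : A →ₗ[k] A ⊗[k] W := f.lTensor A ∘ₗ comul

theorem graph_eq (f : A →ₗ[k] W) : toConv (graph f) =
    toConv (Algebra.TensorProduct.includeLeft : A →ₐ[k] A ⊗[k] W).toLinearMap *
      toConv ((Algebra.TensorProduct.includeRight : W →ₐ[k] A ⊗[k] W).toLinearMap ∘ₗ f) := by
  ext a
  rw [(ℛ k a).convMul_apply]
  change f.lTensor A (comul a) = _
  rw [← (ℛ k a).eq]
  simp

/-- The map `x ⊗ w ↦ ∑ x₁ ⊗ f x₂ * w`. -/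
def translate (f : A →ₗ[k] W) : A ⊗[k] W →ₗ[k] A ⊗[k] W :=
  TensorProduct.lift ((LinearMap.mul k (A ⊗[k] W)).compl₁₂ (graph f)
    (Algebra.TensorProduct.includeRight : W →ₐ[k] A ⊗[k] W).toLinearMap)

theorem translate_tmul (f : A →ₗ[k] W) (x : A) (w : W) :
    translate f (x ⊗ₜ w) = graph f x * (1 ⊗ₜ w) := rfl

theorem translate_mul (f : A →ₗ[k] W) (t : A ⊗[k] W) (w : W) :
    translate f (t * (1 ⊗ₜ w)) = translate f t * (1 ⊗ₜ w) := by
  induction t using TensorProduct.induction_on with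
  | zero => simp
  | add s t hs ht => simp only [add_mul, map_add, hs, ht]
  | tmul x y => simp [translate_tmul, mul_assoc]

/-- `graph f` is the convolution product of the inclusion of A with f followed by the inclusion of
W. Applying `translate g` inserts g between these two factors, so associativity of convolution gives
the claim. -/
theorem translate_graph (f g : A →ₗ[k] W) :
    translate g ∘ₗ graph f = graph (toConv g * toConv f).ofConv := by
  apply toConv_injective
  rw [graph_eq]
  have := algHom_comp_convMul_distrib (Algebra.TensorProduct.includeRight : W →ₐ[k] A ⊗[k] W)
    (toConv g) (toConv f)
  rw [this]
  change _ = toConv (Algebra.TensorProduct.includeLeft : A →ₐ[k] A ⊗[k] W).toLinearMap *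
    (toConv ((Algebra.TensorProduct.includeRight : W →ₐ[k] A ⊗[k] W).toLinearMap ∘ₗ g) *
      toConv ((Algebra.TensorProduct.includeRight : W →ₐ[k] A ⊗[k] W).toLinearMap ∘ₗ f))
  rw [← mul_assoc, ← graph_eq]
  ext a
  rw [(ℛ k a).convMul_apply]
  change translate g (f.lTensor A (comul a)) = _
  rw [← (ℛ k a).eq]
  simp [translate_tmul]

theorem translate_translate (f g : A →ₗ[k] W) (t : A ⊗[k] W) :
    translate g (translate f t) = translate (toConv g * toConv f).ofConv t := by
  induction t using TensorProduct.induction_on with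
  | zero => simp
  | add s t hs ht => simp only [map_add, hs, ht]
  | tmul x w =>
    rw [translate_tmul, translate_mul, translate_tmul, ← translate_graph]
    rfl

theorem translate_one (t : A ⊗[k] W) :
    translate (1 : WithConv (A →ₗ[k] W)).ofConv t = t := by
  induction t using TensorProduct.induction_on with
  | zero => simp
  | add s t hs ht => simp only [map_add, hs, ht]
  | tmul x w =>
    have h : graph (1 : WithConv (A →ₗ[k] W)).ofConv x = x ⊗ₜ 1 := by
      have : toConv (graph (1 : WithConv (A →ₗ[k] W)).ofConv) =
          toConv (Algebra.TensorProduct.includeLeft : A →ₐ[k] A ⊗[k] W).toLinearMap := by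
        rw [graph_eq]
        convert mul_one _
        ext a
        change (1 : A) ⊗ₜ[k] (algebraMap k W (counit a)) = algebraMap k A (counit a) ⊗ₜ[k] (1 : W)
        rw [Algebra.algebraMap_eq_smul_one, Algebra.algebraMap_eq_smul_one, smul_tmul]
      exact congr($this x)
    rw [translate_tmul, h]
    simp

/-- Convolution-inverse maps give inverse translations. -/
def translateEquiv (f g : A →ₗ[k] W) (h₁ : toConv g * toConv f = 1)
    (h₂ : toConv f * toConv g = 1) : A ⊗[k] W ≃ₗ[k] A ⊗[k] W :=
  LinearEquiv.ofLinearMap (translate f) (translate g)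
    (LinearMap.ext fun _ => by
          change translate f (translate g _) = _
          rw [translate_translate, h₂, translate_one]; rfl)
    (LinearMap.ext fun _ => by
          change translate g (translate f _) = _
          rw [translate_translate, h₁, translate_one]; rfl)

end Translation

/-- The antipode as a linear map to the opposite algebra. -/
def antipodeOp : A →ₗ[k] Aᵐᵒᵖ := (opLinearEquiv k).toLinearMap ∘ₗ HopfAlgebra.antipode k

/-- The square of the antipode as a linear map to the opposite algebra. -/
def antipodeSqOp : A →ₗ[k] Aᵐᵒᵖ := antipodeOp ∘ₗ HopfAlgebra.antipode k

theorem antipodeOp_apply (a : A) :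
    antipodeOp (k := k) a = op (HopfAlgebra.antipode k a) := rfl

theorem antipodeSqOp_apply (a : A) : antipodeSqOp (k := k) a =
    op (HopfAlgebra.antipode k (HopfAlgebra.antipode k a)) := rfl

/-- In Aᵒᵖ the product reads S(a₂)S²(a₁) = S(S(a₁)a₂), and the inner sum collapses to ε(a). In
general an algebra map f out of a Hopf algebra has convolution inverse f ∘ S; here f is S, viewed as
a map to Aᵒᵖ. -/
theorem antipodeSqOp_mul_antipodeOp :
    toConv (antipodeSqOp (k := k) (A := A)) * toConv antipodeOp = 1 := by
  ext a
  rw [(ℛ k a).convMul_apply]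
  simp only [antipodeOp_apply, antipodeSqOp_apply, ← MulOpposite.op_mul,
    ← HopfAlgebra.antipode_mul_antidistrib, ← Finset.op_sum, ← map_sum,
    HopfAlgebra.sum_antipode_mul_eq_smul, map_smul, HopfAlgebra.antipode_one]
  rw [convOne_apply, Algebra.algebraMap_eq_smul_one]
  rfl

theorem antipodeOp_mul_antipodeSqOp :
    toConv (antipodeOp (k := k) (A := A)) * toConv antipodeSqOp = 1 := by
  ext a
  rw [(ℛ k a).convMul_apply]
  simp only [antipodeOp_apply, antipodeSqOp_apply, ← MulOpposite.op_mul,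
    ← HopfAlgebra.antipode_mul_antidistrib, ← Finset.op_sum, ← map_sum,
    HopfAlgebra.sum_mul_antipode_eq_smul, map_smul, HopfAlgebra.antipode_one]
  rw [convOne_apply, Algebra.algebraMap_eq_smul_one]
  rfl

/-! ## The winding automorphism and the square of the antipode -/

section Winding

variable (π : A →ₐ[k] k)

/-- An algebra map `A → k`, seen as a map to a `k`-algebra `W`. -/
def scalarMap (W : Type u) [Ring W] [Algebra k W] (π : A →ₐ[k] k) : A →ₗ[k] W :=
  Algebra.linearMap k W ∘ₗ π.toLinearMap

theorem scalarMap_mul (W : Type u) [Ring W] [Algebra k W] (π φ : A →ₐ[k] k)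
    (h : LinearMap.mul' k k ∘ₗ TensorProduct.map π.toLinearMap φ.toLinearMap ∘ₗ
      Coalgebra.comul = Coalgebra.counit) :
    toConv (scalarMap W π) * toConv (scalarMap W φ) = 1 := by
  ext a
  have h' := LinearMap.congr_fun h a
  rw [(ℛ k a).convMul_apply, convOne_apply, ← h']
  conv_rhs => rw [LinearMap.comp_apply, LinearMap.comp_apply, ← (ℛ k a).eq]
  simp [scalarMap]

theorem leftWindingHom_conv : toConv (leftWindingHom π).toLinearMap =
    toConv (scalarMap A π) * toConv LinearMap.id := by
  ext a
  rw [(ℛ k a).convMul_apply]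
  change leftWindingHom π a = _
  rw [leftWindingHom_eq, ← (ℛ k a).eq]
  simp [scalarMap, Algebra.smul_def]

theorem leftWindingHom_eq_sum (a : A) : leftWindingHom π a =
    ∑ i ∈ (ℛ k a).index, π ((ℛ k a).left i) • (ℛ k a).right i := by
  rw [leftWindingHom_eq]
  conv_lhs => rw [← (ℛ k a).eq]
  simp

/-- Both sides are convolution inverses of ξ: the left one because ξ is an algebra map, the right
one because ξ is the convolution product of π with the identity, whose inverse is S followed by π ∘
S. -/
theorem leftWindingHom_antipode (a : A) :
    leftWindingHom π (HopfAlgebra.antipode k a) =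
      ∑ i ∈ (ℛ k a).index, π (HopfAlgebra.antipode k ((ℛ k a).right i)) •
        HopfAlgebra.antipode k ((ℛ k a).left i) := by
  have h₁ : toConv ((leftWindingHom π).toLinearMap ∘ₗ HopfAlgebra.antipode k) *
      toConv (leftWindingHom π).toLinearMap = 1 := by
    have := algHom_comp_convMul_distrib (leftWindingHom π)
      (toConv (HopfAlgebra.antipode k)) (toConv (LinearMap.id : A →ₗ[k] A))
    rw [antipode_mul_id] at this
    have h := congrArg toConv this
    rw [toConv_ofConv] at h
    refine h.symm.trans ?_
    ext a
    simp
  have h₂ : toConv (leftWindingHom π).toLinearMap * (toConv (HopfAlgebra.antipode k) *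
      toConv (scalarMap A (characterInv π))) = 1 := by
    rw [leftWindingHom_conv, mul_assoc, ← mul_assoc (toConv LinearMap.id), id_mul_antipode, one_mul,
      scalarMap_mul _ _ _ (conv_characterInv π)]
  have h := congr($(left_inv_eq_right_inv h₁ h₂) a)
  rw [(ℛ k a).convMul_apply] at h
  refine h.trans (Finset.sum_congr rfl fun i _ => ?_)
  simp [scalarMap, characterInv_apply, Algebra.smul_def, Algebra.commutes]

/-- This puts ν = ξS² in the form in which it arises from the expansion of c ⊗ 1 along `diag`. It is
again uniqueness of convolution inverses, now with values in Aᵒᵖ: both sides invert a ↦ op (ξ(S a)),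
which the previous lemma factors as S times π ∘ S. -/
theorem leftWindingHom_antipode_antipode (a : A) :
    leftWindingHom π (HopfAlgebra.antipode k (HopfAlgebra.antipode k a)) =
      ∑ i ∈ (ℛ k a).index, π ((ℛ k a).left i) •
        HopfAlgebra.antipode k (HopfAlgebra.antipode k ((ℛ k a).right i)) := by
  let w : A →ₗ[k] Aᵐᵒᵖ := (opLinearEquiv k).toLinearMap ∘ₗ (leftWindingHom π).toLinearMap
  have hw : ∀ a, w a = op (leftWindingHom π a) := fun _ => rfl
  have h₁ : toConv (w ∘ₗ HopfAlgebra.antipode k ∘ₗ HopfAlgebra.antipode k) *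
      toConv (w ∘ₗ HopfAlgebra.antipode k) = 1 := by
    ext a
    rw [(ℛ k a).convMul_apply]
    simp only [LinearMap.comp_apply, hw, ← MulOpposite.op_mul, ← map_mul,
      ← HopfAlgebra.antipode_mul_antidistrib, ← Finset.op_sum, ← map_sum,
      HopfAlgebra.sum_antipode_mul_eq_smul, map_smul, HopfAlgebra.antipode_one, map_one]
    rw [convOne_apply, Algebra.algebraMap_eq_smul_one]
    rfl
  have h₂ : toConv (w ∘ₗ HopfAlgebra.antipode k) =
      toConv antipodeOp * toConv (scalarMap Aᵐᵒᵖ (characterInv π)) := by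
    ext a
    rw [(ℛ k a).convMul_apply]
    change op (leftWindingHom π (HopfAlgebra.antipode k a)) = _
    rw [leftWindingHom_antipode, Finset.op_sum]
    refine Finset.sum_congr rfl fun i _ => ?_
    simp [scalarMap, characterInv_apply, Algebra.smul_def, antipodeOp_apply,
      ← MulOpposite.op_mul, Algebra.commutes]
  have h₃ : toConv (w ∘ₗ HopfAlgebra.antipode k) *
      (toConv (scalarMap Aᵐᵒᵖ π) * toConv antipodeSqOp) = 1 := by
    rw [h₂, mul_assoc, ← mul_assoc (toConv (scalarMap Aᵐᵒᵖ (characterInv π))),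
      scalarMap_mul _ _ _ (characterInv_conv π), one_mul, antipodeOp_mul_antipodeSqOp]
  have h := congr(unop ($(left_inv_eq_right_inv h₁ h₃) a))
  rw [(ℛ k a).convMul_apply] at h
  refine h.trans ?_
  rw [Finset.unop_sum]
  refine Finset.sum_congr rfl fun i _ => ?_
  simp [scalarMap, Algebra.smul_def, antipodeSqOp_apply, Algebra.commutes]

end Winding

end Convolution

/-! ## Restriction of scalars and injective modules -/

theorem restrictScalars_map_exact {A E : Type u} [Ring A] [Ring E] (φ : A →+* E)
    (S : ShortComplex (ModuleCat.{u} E)) (h : S.Exact) :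
    (S.map (ModuleCat.restrictScalars.{u} φ)).Exact := by
  rw [ShortComplex.ShortExact.moduleCat_exact_iff_function_exact] at h ⊢
  exact h

instance {A E : Type u} [Ring A] [Ring E] (φ : A →+* E) :
    Limits.PreservesFiniteLimits (ModuleCat.restrictScalars.{u} φ) := by
  have := ((Functor.exact_tfae (ModuleCat.restrictScalars.{u} φ)).out 1 3).mp
    (restrictScalars_map_exact φ)
  exact this.1

section RightBasis

/-- A family `e` of elements of `E` is a right basis over a ring homomorphism `φ : A → E` if each
element of `E` is uniquely a combination `∑ e s * φ (a s)`. -/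
def IsRightBasis {A E ι : Type u} [Ring A] [Ring E] (φ : A →+* E) (e : ι → E) : Prop :=
  Function.Bijective (Finsupp.liftAddHom fun s => (AddMonoidHom.mulLeft (e s)).comp
    φ.toAddMonoidHom : (ι →₀ A) →+ E)

variable {A E ι : Type u} [Ring A] [Ring E] {φ : A →+* E} {e : ι → E}

/-- Conceptually, E is free, hence flat, as a right A-module, so restriction has the exact left
adjoint E ⊗_A -. The proof applies Baer's criterion: a map J → I on a left ideal J extends
E-linearly to E·φ(J), which is E ⊗_A J by freeness, then to E, and is finally restricted along φ. -/
theorem injective_restrictScalars (h : IsRightBasis φ e) (I : ModuleCat.{u} E) [Injective I] :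
    Injective ((ModuleCat.restrictScalars.{u} φ).obj I) := by
  have hI : Module.Injective E I := Module.injective_module_of_injective_object E I
  let _ : Module A I := Module.compHom I φ
  have hsmul : ∀ (a : A) (x : I), a • x = φ a • x := fun _ _ => rfl
  suffices Module.Injective A I from Module.injective_object_of_injective_module A I
  apply Module.Baer.injective
  intro J f
  -- Finitely supported families in J model E ⊗_A J: `c` is its multiplication map to E, injective
  -- by the basis property, and `G` is the E-linear extension of f.
  let c : (ι →₀ J) →+ E := Finsupp.liftAddHom fun s =>
    ((AddMonoidHom.mulLeft (e s)).comp φ.toAddMonoidHom).comp J.subtype.toAddMonoidHom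
  let G : (ι →₀ J) →+ I := Finsupp.liftAddHom fun s =>
    (DistribSMul.toAddMonoidHom I (e s)).comp f.toAddMonoidHom
  have c_single : ∀ s j, c (Finsupp.single s j) = e s * φ j := fun s j => by simp [c]
  have G_single : ∀ s j, G (Finsupp.single s j) = e s • f j := fun s j => by simp [G]
  have c_inj : Function.Injective c := by
    have : c = (Finsupp.liftAddHom fun s => (AddMonoidHom.mulLeft (e s)).comp
        φ.toAddMonoidHom : (ι →₀ A) →+ E).comp
          (Finsupp.mapRange.addMonoidHom J.subtype.toAddMonoidHom) := by
      ext s j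
      simp [c]
    rw [this]
    exact h.injective.comp (Finsupp.mapRange_injective _ rfl J.injective_subtype)
  -- Expand x in the right basis; each coefficient a is absorbed into J, because J is a left ideal
  -- and f is A-linear.
  have key' : ∀ (x : E) (j : J), ∃ b', c b' = x * φ j ∧ G b' = x • f j := by
    intro x j
    obtain ⟨a, rfl⟩ := h.surjective x
    induction a using Finsupp.induction_linear with
    | zero => exact ⟨0, by simp, by simp⟩
    | add b₁ b₂ h₁ h₂ =>
      obtain ⟨b₁', h₁, h₁'⟩ := h₁
      obtain ⟨b₂', h₂, h₂'⟩ := h₂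
      exact ⟨b₁' + b₂', by rw [map_add, map_add, h₁, h₂, add_mul],
        by rw [map_add, map_add, h₁', h₂', add_smul]⟩
    | single t a =>
      refine ⟨Finsupp.single t (a • j), ?_, ?_⟩
      · rw [c_single]
        simp [mul_assoc]
      · rw [G_single, map_smul, hsmul]
        simp [smul_smul]
  have key : ∀ (x : E) (b : ι →₀ J), ∃ b', c b' = x * c b ∧ G b' = x • G b := by
    intro x b
    induction b using Finsupp.induction_linear with
    | zero => exact ⟨0, by simp, by simp⟩
    | add b₁ b₂ h₁ h₂ =>
      obtain ⟨b₁', h₁, h₁'⟩ := h₁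
      obtain ⟨b₂', h₂, h₂'⟩ := h₂
      exact ⟨b₁' + b₂', by rw [map_add, map_add, h₁, h₂, mul_add],
        by rw [map_add, map_add, h₁', h₂', smul_add]⟩
    | single s j =>
      rw [c_single, G_single, ← mul_assoc, smul_smul]
      exact key' _ j
  let J' : Submodule E E :=
    { carrier := Set.range c
      add_mem' := by
        rintro _ _ ⟨b₁, rfl⟩ ⟨b₂, rfl⟩
        exact ⟨b₁ + b₂, map_add _ _ _⟩
      zero_mem' := ⟨0, map_zero _⟩
      smul_mem' := by
        rintro x _ ⟨b, rfl⟩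
        obtain ⟨b', h, -⟩ := key x b
        exact ⟨b', h⟩ }
  let inv : J' → (ι →₀ J) := fun y => y.2.choose
  have inv_spec : ∀ y : J', c (inv y) = y := fun y => y.2.choose_spec
  let g : J' →ₗ[E] I :=
    { toFun := fun y => G (inv y)
      map_add' := fun y z => by
        rw [← map_add]
        congr 1
        apply c_inj
        rw [map_add, inv_spec, inv_spec, inv_spec]
        rfl
      map_smul' := fun x y => by
        obtain ⟨b', h₁, h₂⟩ := key x (inv y)
        rw [RingHom.id_apply, ← h₂]
        congr 1
        apply c_inj
        rw [h₁, inv_spec, inv_spec]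
        rfl }
  obtain ⟨g', hg'⟩ := Module.Baer.of_injective hI J' g
  refine ⟨{ toFun := fun a => g' (φ a), map_add' := fun x y => by rw [map_add, map_add],
            map_smul' := fun a x => ?_ }, fun x hx => ?_⟩
  · rw [smul_eq_mul, map_mul, ← smul_eq_mul, map_smul]
    rfl
  · obtain ⟨b, h₁, h₂⟩ := key' 1 ⟨x, hx⟩
    rw [one_mul] at h₁
    rw [one_smul] at h₂
    have hmem : φ x ∈ J' := ⟨b, h₁⟩
    refine (hg' _ hmem).trans (Eq.trans ?_ h₂)
    change G _ = G b
    congr 1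
    exact c_inj ((inv_spec _).trans h₁.symm)

end RightBasis

/-! ## The enveloping algebra of a Hopf algebra -/

section Diagonal

open WithConv Coalgebra

variable (k A : Type u) [Field k] [Ring A] [HopfAlgebra k A]

/-- The algebra map `A → Aᵉ`, `a ↦ ∑ a₁ ⊗ op (S a₂)`. -/
def diag : A →ₐ[k] Env k A :=
  (Algebra.TensorProduct.map (AlgHom.id k A) (HopfAlgebra.antipodeAlgHomOp k A)).comp
    (Bialgebra.comulAlgHom k A)

variable {A}

theorem diag_eq_sum (a : A) : diag k A a =
    ∑ i ∈ (ℛ k a).index, (ℛ k a).left i ⊗ₜ op (HopfAlgebra.antipode k ((ℛ k a).right i)) := by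
  change TensorProduct.map _ _ (comul a) = _
  conv_lhs => rw [← (ℛ k a).eq]
  simp

variable (A) in
/-- The bijection `A ⊗ Aᵒᵖ → Aᵉ`, `x ⊗ op y ↦ diag x * (1 ⊗ op y)`. -/
def diagLeft : A ⊗[k] Aᵐᵒᵖ ≃ₗ[k] Env k A :=
  translateEquiv antipodeOp antipodeSqOp antipodeSqOp_mul_antipodeOp antipodeOp_mul_antipodeSqOp

theorem diagLeft_tmul (x : A) (w : Aᵐᵒᵖ) : diagLeft k A (x ⊗ₜ w) = diag k A x * (1 ⊗ₜ w) := rfl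

theorem diagLeft_symm_tmul (x y : A) : (diagLeft k A).symm (x ⊗ₜ op y) =
    ∑ i ∈ (ℛ k x).index, (ℛ k x).left i ⊗ₜ
      op (y * HopfAlgebra.antipode k (HopfAlgebra.antipode k ((ℛ k x).right i))) := by
  have h : graph (antipodeSqOp (k := k)) x = ∑ i ∈ (ℛ k x).index, (ℛ k x).left i ⊗ₜ
      op (HopfAlgebra.antipode k (HopfAlgebra.antipode k ((ℛ k x).right i))) := by
    conv_lhs => rw [graph, LinearMap.comp_apply, ← (ℛ k x).eq]
    simp [antipodeSqOp_apply]
  have h' : (diagLeft k A).symm (x ⊗ₜ op y) = graph (antipodeSqOp (k := k)) x * (1 ⊗ₜ op y) :=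
    translate_tmul _ _ _
  rw [h', h]
  simp [Finset.sum_mul]

/-- The inverse of `diagLeft` is translation by S². This expansion of an arbitrary tensor in the
free left A-module ad Aᵉ is what introduces S² into the Nakayama automorphism. -/
theorem tmul_eq_sum_diag (x y : A) : (x ⊗ₜ op y : Env k A) =
    ∑ i ∈ (ℛ k x).index, diag k A ((ℛ k x).left i) * envR k
      (y * HopfAlgebra.antipode k (HopfAlgebra.antipode k ((ℛ k x).right i))) := by
  rw [← (diagLeft k A).apply_symm_apply (x ⊗ₜ op y), diagLeft_symm_tmul, map_sum]
  simp only [diagLeft_tmul]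

variable (A) in
/-- The bijection `A ⊗ A → Aᵉ`, `x ⊗ y ↦ (1 ⊗ op y) * diag x`. -/
def diagRight : A ⊗[k] A ≃ₗ[k] Env k A :=
  (translateEquiv (HopfAlgebra.antipode k) LinearMap.id LinearMap.id_mul_antipode
    LinearMap.antipode_mul_id).trans
    (TensorProduct.congr (LinearEquiv.refl k A) (opLinearEquiv k))

theorem diagRight_tmul (x y : A) : diagRight k A (x ⊗ₜ y) = envR k y * diag k A x := by
  rw [diag_eq_sum]
  change TensorProduct.congr (LinearEquiv.refl k A) (opLinearEquiv k)
    ((LinearMap.lTensor A (HopfAlgebra.antipode k) (comul x)) * (1 ⊗ₜ y)) = _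
  conv_lhs => rw [← (ℛ k x).eq]
  simp [Finset.sum_mul, Finset.mul_sum]

theorem diagRight_symm_tmul (x : A) : (diagRight k A).symm (x ⊗ₜ op 1) = comul x := by
  change graph LinearMap.id x * (1 ⊗ₜ 1) = _
  rw [← Algebra.TensorProduct.one_def, mul_one, graph, LinearMap.lTensor_id]
  rfl

/-- The inverse of `diagRight` is translation by the identity, hence the plain coproduct. The
formula turns invariance under the adjoint action into commutation with A. -/
theorem envL_eq_sum_diag (x : A) : envL k x =
    ∑ i ∈ (ℛ k x).index, envR k ((ℛ k x).right i) * diag k A ((ℛ k x).left i) := by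
  rw [envL, ← op_one, ← (diagRight k A).apply_symm_apply (x ⊗ₜ op 1), diagRight_symm_tmul]
  conv_lhs => rw [← (ℛ k x).eq]
  rw [map_sum]
  simp only [diagRight_tmul]

/-- `diagRight` transports the evident basis of A ⊗ A over its first factor. With this, restriction
along `diag` preserves injectives. -/
theorem isRightBasis_diag {ι : Type u} (b : Module.Basis ι k A) :
    IsRightBasis (diag k A).toRingHom fun s => envR k (b s) := by
  classical
  have : ⇑(Finsupp.liftAddHom fun s => (AddMonoidHom.mulLeft (envR k (b s))).comp
      (diag k A).toRingHom.toAddMonoidHom : (ι →₀ A) →+ Env k A) =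
      (TensorProduct.equivFinsuppOfBasisRight (M := A) b).symm.trans (diagRight k A) := by
    ext a
    induction a using Finsupp.induction_linear with
    | zero => simp
    | add x y hx hy => rw [map_add, map_add, hx, hy]
    | single s x =>
      rw [LinearEquiv.trans_apply]
      have : (TensorProduct.equivFinsuppOfBasisRight (M := A) b).symm (Finsupp.single s x) =
          x ⊗ₜ b s := by
        rw [LinearEquiv.symm_apply_eq]
        ext t
        simp [Finsupp.single_apply]
      rw [this, diagRight_tmul]
      simp
  rw [IsRightBasis, this]
  exact LinearEquiv.bijective _

theorem isRightBasis_includeLeft {B C ι : Type u} [Ring B] [Algebra k B] [Ring C] [Algebra k C]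
    (b : Module.Basis ι k C) :
    IsRightBasis (Algebra.TensorProduct.includeLeft : B →ₐ[k] B ⊗[k] C).toRingHom
      fun s => (1 : B) ⊗ₜ[k] b s := by
  classical
  have : ⇑(Finsupp.liftAddHom fun s => (AddMonoidHom.mulLeft ((1 : B) ⊗ₜ[k] b s)).comp
      (Algebra.TensorProduct.includeLeft : B →ₐ[k] B ⊗[k] C).toRingHom.toAddMonoidHom :
        (ι →₀ B) →+ B ⊗[k] C) =
      (TensorProduct.equivFinsuppOfBasisRight (M := B) b).symm := by
    ext a
    induction a using Finsupp.induction_linear with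
    | zero => simp
    | add x y hx hy => rw [map_add, map_add, hx, hy]
    | single s x =>
      rw [eq_comm, LinearEquiv.symm_apply_eq]
      ext t
      simp [Finsupp.single_apply]
  rw [IsRightBasis, this]
  exact LinearEquiv.bijective _

end Diagonal

/-- Restriction along `B → B ⊗ C` preserves injective objects. -/
instance {k B C : Type u} [Field k] [Ring B] [Algebra k B] [Ring C] [Algebra k C] :
    (ModuleCat.restrictScalars.{u}
      (Algebra.TensorProduct.includeLeft : B →ₐ[k] B ⊗[k] C).toRingHom).PreservesInjectiveObjects where
  injective_obj {I} _ :=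
    injective_restrictScalars (isRightBasis_includeLeft k (Module.Basis.ofVectorSpace k C)) I

/-- Restriction along `diag : A → Aᵉ` preserves injective objects. -/
instance {k A : Type u} [Field k] [Ring A] [HopfAlgebra k A] :
    (ModuleCat.restrictScalars.{u} (diag k A).toRingHom).PreservesInjectiveObjects where
  injective_obj {I} _ :=
    injective_restrictScalars (isRightBasis_diag k (Module.Basis.ofVectorSpace k A)) I

/-! ## Comparison of `Ext` groups along exact functors -/

section ExtComparison

open Abelian

universe w w' v v' u₁ u₂

variable {C : Type u₁} [Category.{v} C] [Abelian C] {D : Type u₂} [Category.{v'} D] [Abelian D]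
  (F : C ⥤ D) [F.Additive] [Limits.PreservesFiniteLimits F] [Limits.PreservesFiniteColimits F]
  [HasExt.{w} C] [HasExt.{w'} D]

/-- The map `Ext^n(X, M) → Ext^n(Y, F M)` induced by an exact functor `F` and `u : Y ⟶ F X`. -/
def extTransfer {X : C} {Y : D} (v : Y ⟶ F.obj X) (M : C) (n : ℕ) :
    Ext.{w} X M n →+ Ext.{w'} Y (F.obj M) n where
  toFun x := (Ext.mk₀ v).comp (x.mapExactFunctor F) (zero_add n)
  map_zero' := by simp
  map_add' x y := by simp

theorem extTransfer_apply {X : C} {Y : D} (v : Y ⟶ F.obj X) (M : C) (n : ℕ) (x : Ext.{w} X M n) :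
    extTransfer F v M n x = (Ext.mk₀ v).comp (x.mapExactFunctor F) (zero_add n) := rfl

theorem extTransfer_comp {X : C} {Y : D} (v : Y ⟶ F.obj X) {M N : C} {n m p : ℕ}
    (x : Ext.{w} X M n) (y : Ext.{w} M N m) (h : n + m = p) :
    extTransfer F v N p (x.comp y h) =
      (extTransfer F v M n x).comp (y.mapExactFunctor F) h := by
  rw [extTransfer_apply, extTransfer_apply, Ext.mapExactFunctor_comp, Ext.comp_assoc]
  omega

-- Degree 0 is the hypothesis `hv`, that X represents Hom(Y, F -) through v. The induction embeds M
-- in an injective object: its `Ext` and that of its image under F vanish in positive degrees, so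
-- degree n + 1 for M is the cokernel of a map in degree n on both sides.
attribute [local instance] Ext.subsingleton_of_injective in
theorem extTransfer_bijective [EnoughInjectives C] [F.PreservesInjectiveObjects] {X : C} {Y : D}
    (v : Y ⟶ F.obj X) (hv : ∀ M : C, Function.Bijective fun f : X ⟶ M => v ≫ F.map f) (M : C)
    (n : ℕ) : Function.Bijective (extTransfer F v M n) := by
  induction n generalizing M with
  | zero =>
    have : ⇑(extTransfer F v M 0) ∘ Ext.mk₀ = Ext.mk₀ ∘ fun f : X ⟶ M => v ≫ F.map f := by
      ext f
      simp [extTransfer_apply, Ext.mapExactFunctor_mk₀]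
    rw [← Function.Bijective.of_comp_iff _ (Ext.mk₀_bijective X M), this]
    exact (Ext.mk₀_bijective _ _).comp (hv M)
  | succ n hn =>
    let I : InjectivePresentation M := Classical.arbitrary _
    let S := ShortComplex.mk _ _ (Limits.cokernel.condition I.f)
    have : Injective (S.map F).X₂ := Functor.PreservesInjectiveObjects.injective_obj I.injective
    have hS : S.ShortExact := { exact := ShortComplex.exact_cokernel I.f }
    exact AddMonoidHom.bijective_of_surjective_of_bijective_of_right_exact _ _ _ _
      (extTransfer F v S.X₂ n) (extTransfer F v S.X₃ n) (extTransfer F v S.X₁ (n + 1))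
      (by
        ext x
        simp [extTransfer_comp, Ext.mapExactFunctor_mk₀]
        rfl)
      (by
        ext x
        simp [extTransfer_comp, Ext.mapExactFunctor_extClass]
        rfl)
      ((ShortComplex.ab_exact_iff_function_exact _).mp
        (Ext.covariant_sequence_exact₃' X hS n (n + 1) rfl))
      ((ShortComplex.ab_exact_iff_function_exact _).mp
        (Ext.covariant_sequence_exact₃' Y (hS.map F) n (n + 1) rfl))
      (hn _).surjective (hn _)
      (fun x₁ ↦ Ext.covariant_sequence_exact₁ _ hS x₁ (by subsingleton) rfl)
      (fun y₁ ↦ Ext.covariant_sequence_exact₁ _ (hS.map F) y₁ (by subsingleton) rfl)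

end ExtComparison

/-! ## `Ext` of finitely generated modules into free modules -/

section ExtFree

open Abelian

variable {A : Type u} [Ring A] {ι : Type u}

/-- The projection of a direct sum of copies of `A` onto a finite subsum. -/
def truncSum (S : Finset ι) : ModuleCat.of A (ι →₀ A) ⟶ ModuleCat.of A (ι →₀ A) :=
  ∑ s ∈ S, ModuleCat.ofHom (Finsupp.lapply s) ≫ ModuleCat.ofHom (Finsupp.lsingle s)

theorem truncSum_apply (S : Finset ι) (f : ι →₀ A) : (truncSum S).hom f =
    ∑ s ∈ S, Finsupp.single s (f s) := by
  simp [truncSum]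

theorem exists_truncSum_eq_hom {X : ModuleCat.{u} A} [Module.Finite A X]
    (f : X ⟶ ModuleCat.of A (ι →₀ A)) : ∃ S : Finset ι, f ≫ truncSum S = f := by
  classical
  obtain ⟨G, hG⟩ := ‹Module.Finite A X›.fg_top
  refine ⟨G.biUnion fun x => (f.hom x).support, ?_⟩
  apply ModuleCat.hom_ext
  apply LinearMap.ext_on hG
  intro x hx
  change (truncSum _).hom (f.hom x) = f.hom x
  rw [truncSum_apply]
  conv_rhs => rw [← Finsupp.sum_single (f.hom x)]
  refine (Finset.sum_subset ?_ ?_).symm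
  · exact Finset.subset_biUnion_of_mem (fun x => (f.hom x).support) hx
  · intro s _ hs
    simp [Finsupp.notMem_support_iff.1 hs]

-- `Ext` out of a finitely generated module over a noetherian ring commutes with direct sums: every
-- class is supported on finitely many coordinates. For homomorphisms, a finite generating set
-- suffices; higher degrees follow by dimension shifting in X.
attribute [local instance] Ext.subsingleton_of_projective in
theorem exists_truncSum_eq [IsNoetherianRing A] (n : ℕ) (X : ModuleCat.{u} A) [Module.Finite A X]
    (x : Ext.{u} X (ModuleCat.of A (ι →₀ A)) n) :
    ∃ S : Finset ι, x.comp (Ext.mk₀ (truncSum S)) (add_zero n) = x := by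
  induction n generalizing X with
  | zero =>
    obtain ⟨f, rfl⟩ := (Ext.mk₀_bijective _ _).2 x
    obtain ⟨S, hS⟩ := exists_truncSum_eq_hom f
    exact ⟨S, by simp [hS]⟩
  | succ n hn =>
    -- The kernel of a finite free cover is again finitely generated because A is noetherian, so the
    -- induction hypothesis applies to it.
    obtain ⟨m, p, hp⟩ := Module.Finite.exists_fin' A X
    let S := p.shortComplexKer
    have hS : S.ShortExact := LinearMap.shortExact_shortComplexKer hp
    have : Projective S.X₂ := ModuleCat.projective_of_free (Pi.basisFun A (Fin m))
    have : Module.Finite A S.X₁ := inferInstanceAs (Module.Finite A (LinearMap.ker p))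
    obtain ⟨y, rfl⟩ := Ext.contravariant_sequence_exact₃ hS _ x (by subsingleton) (add_comm 1 n)
    obtain ⟨T, hT⟩ := hn _ y
    exact ⟨T, by rw [Ext.comp_assoc_of_third_deg_zero, hT]⟩

end ExtFree

/-! ## Hochschild cohomology of a Hopf algebra -/

section Bimodules

variable {k A : Type u} [Field k] [Ring A] [Algebra k A]

variable (k A) in
/-- The elements of the regular bimodule. -/
def toRegular : A ≃+ regularBimodule k A := AddEquiv.refl A

theorem smul_toRegular (a b x : A) :
    (a ⊗ₜ[k] op b : Env k A) • toRegular k A x = toRegular k A (a * x * b) :=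
  (TensorProduct.Algebra.smul_def (A := A) (B := Aᵐᵒᵖ) (M := A) a (op b) x).trans
    (mul_assoc a x b).symm

theorem envL_smul_toRegular (a x : A) : envL k a • toRegular k A x = toRegular k A (a * x) :=
  (smul_toRegular a 1 x).trans (by rw [mul_one])

theorem algebraMap_smul_toRegular (r : k) (x : A) :
    algebraMap k (Env k A) r • toRegular k A x = toRegular k A (algebraMap k A r * x) := by
  rw [Algebra.TensorProduct.algebraMap_apply]
  exact envL_smul_toRegular _ _

/-- The elements of the trivial bimodule. -/
def toTrivial (ε : A →ₐ[k] k) : k ≃+ trivialBimodule ε := AddEquiv.refl k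

theorem smul_toTrivial (ε : A →ₐ[k] k) (a b : A) (x : k) :
    (a ⊗ₜ[k] op b : Env k A) • toTrivial ε x = toTrivial ε (ε a * ε b * x) := by
  change envAugmentation ε (a ⊗ₜ op b) * x = _
  simp [envAugmentation]
  rfl

/-- The elements of a twisted bimodule. -/
def toTwist (σ τ : A ≃ₐ[k] A) (M : ModuleCat.{u} (Env k A)) : M ≃+ twist σ τ M :=
  AddEquiv.refl M

theorem smul_toTwist (σ τ : A ≃ₐ[k] A) (M : ModuleCat.{u} (Env k A)) (a b : A) (x : M) :
    (a ⊗ₜ[k] op b : Env k A) • toTwist σ τ M x =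
      toTwist σ τ M ((σ a ⊗ₜ[k] op (τ b) : Env k A) • x) := rfl

/-- An additive map which commutes with the scalars is a morphism of modules. -/
def homOfSmul {R : Type u} [Ring R] {M N : ModuleCat.{u} R} (f : M →+ N)
    (h : ∀ (r : R) (x : M), f (r • x) = r • f x) : M ⟶ N :=
  ModuleCat.ofHom { f with map_smul' := h }

/-- An additive bijection which commutes with the scalars is an isomorphism of modules. -/
def isoOfSmul {R : Type u} [Ring R] {M N : ModuleCat.{u} R} (f : M ≃+ N)
    (h : ∀ (r : R) (x : M), f (r • x) = r • f x) : M ≅ N :=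
  LinearEquiv.toModuleIso { f with map_smul' := h }

theorem map_smul_of_tmul {B C : Type u} [Ring B] [Algebra k B] [Ring C] [Algebra k C]
    {M N : ModuleCat.{u} (B ⊗[k] C)} (f : M →+ N)
    (h : ∀ (b : B) (c : C) (x : M), f ((b ⊗ₜ[k] c) • x) = (b ⊗ₜ[k] c) • f x)
    (e : B ⊗[k] C) (x : M) : f (e • x) = e • f x := by
  induction e using TensorProduct.induction_on with
  | zero =>
    exact (congrArg f (zero_smul (B ⊗[k] C) x)).trans
      ((map_zero f).trans (zero_smul (B ⊗[k] C) (f x)).symm)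
  | add e e' he he' => rw [add_smul, add_smul, map_add, he, he']
  | tmul b c => exact h b c x

end Bimodules

/-! ### Hochschild cohomology as `Ext` of the trivial module -/

section Hochschild

open Abelian WithConv Coalgebra

variable (k A : Type u) [Field k] [Ring A] [HopfAlgebra k A]

/-- The trivial left module. -/
abbrev trivialLeft : ModuleCat.{u} A :=
  (resLeft k A).obj (trivialBimodule (Bialgebra.counitAlgHom k A))

/-- The elements of the trivial left module. -/
def toTrivialLeft : k ≃+ trivialLeft k A := toTrivial (Bialgebra.counitAlgHom k A)

variable {k A} in
theorem smul_toTrivialLeft (a : A) (x : k) :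
    a • toTrivialLeft k A x = toTrivialLeft k A (counit a * x) := by
  refine (smul_toTrivial (Bialgebra.counitAlgHom k A) a 1 x).trans ?_
  rw [map_one, mul_one]
  rfl

/-- Restriction along `diag : A → Aᵉ`, turning a bimodule into a left module by the adjoint
action. -/
abbrev adjointRes : ModuleCat.{u} (Env k A) ⥤ ModuleCat.{u} A :=
  ModuleCat.restrictScalars (diag k A).toRingHom

variable {k A} in
-- Expanding b ⊗ 1 along `diag` gives bm = ∑ (δ(b₁)m)b₂ = ∑ ε(b₁)mb₂ = mb.
theorem envL_smul_of_invariant (M : ModuleCat.{u} (Env k A)) (m : M)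
    (hm : ∀ a : A, diag k A a • m = algebraMap k (Env k A) (counit a) • m) (b : A) :
    envL k b • m = envR k b • m := by
  rw [envL_eq_sum_diag, Finset.sum_smul]
  have h : envR k b = ∑ i ∈ (ℛ k b).index,
      envR k ((ℛ k b).right i) * algebraMap k (Env k A) (counit ((ℛ k b).left i)) := by
    conv_lhs => rw [← sum_counit_smul (ℛ k b)]
    simp only [envR, Finset.op_sum, TensorProduct.tmul_sum, op_smul, TensorProduct.tmul_smul]
    refine Finset.sum_congr rfl fun i _ => ?_
    exact (Algebra.smul_def (A := Env k A) _ _).trans (Algebra.commutes (A := Env k A) _ _)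
  rw [h, Finset.sum_smul]
  refine Finset.sum_congr rfl fun i _ => ?_
  rw [mul_smul, mul_smul, hm]

variable {k A} in
theorem diag_smul_one (a : A) :
    diag k A a • toRegular k A 1 = toRegular k A (algebraMap k A (counit a)) := by
  rw [diag_eq_sum, Finset.sum_smul, ← HopfAlgebra.sum_mul_antipode_eq_algebraMap_counit (ℛ k a),
    map_sum]
  refine Finset.sum_congr rfl fun i _ => ?_
  rw [smul_toRegular, mul_one]

/-- The inclusion of the trivial module into the adjoint module of the regular bimodule. -/
def adjointUnit : trivialLeft k A ⟶ (adjointRes k A).obj (regularBimodule k A) :=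
  homOfSmul (((toRegular k A).toAddMonoidHom.comp (algebraMap k A).toAddMonoidHom).comp
    (toTrivialLeft k A).symm.toAddMonoidHom) fun a r => by
      obtain ⟨r, rfl⟩ := (toTrivialLeft k A).surjective r
      rw [smul_toTrivialLeft]
      change toRegular k A (algebraMap k A (counit a * r)) =
        diag k A a • toRegular k A (algebraMap k A r)
      rw [← mul_one (algebraMap k A r), ← algebraMap_smul_toRegular, smul_smul,
        ← Algebra.commutes, mul_smul, diag_smul_one, algebraMap_smul_toRegular, ← map_mul,
        mul_comm]

/-- Both sides are the central elements of M: a bimodule map from A is determined by the image m of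
1, and a map from k to ad M by an adjoint-invariant m. Conversely, x ↦ xm is a bimodule map since
invariant elements commute with A. -/
theorem adjointUnit_bijective (M : ModuleCat.{u} (Env k A)) :
    Function.Bijective fun f : regularBimodule k A ⟶ M =>
      adjointUnit k A ≫ (adjointRes k A).map f := by
  constructor
  · intro f g h
    have h1 : f.hom (toRegular k A 1) = g.hom (toRegular k A 1) := by
      have : f.hom (toRegular k A (algebraMap k A 1)) = g.hom (toRegular k A (algebraMap k A 1)) :=
        congr($(h).hom (toTrivialLeft k A 1))
      rwa [map_one] at this
    ext x
    obtain ⟨x, rfl⟩ := (toRegular k A).surjective x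
    rw [← mul_one x, ← envL_smul_toRegular, map_smul, map_smul, h1]
  · intro g
    let m : M := g.hom (toTrivialLeft k A 1)
    have hsmul : ∀ a : A, diag k A a • m = g.hom (toTrivialLeft k A (counit a)) := by
      intro a
      rw [← mul_one (counit a), ← smul_toTrivialLeft, map_smul]
      rfl
    have hk : ∀ r : k, g.hom (toTrivialLeft k A r) = algebraMap k (Env k A) r • m := by
      intro r
      rw [← (diag k A).commutes, hsmul, Bialgebra.counit_algebraMap]
    have hm : ∀ a : A, diag k A a • m = algebraMap k (Env k A) (counit a) • m := fun a => by
      rw [hsmul, hk]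
    let f₀ : regularBimodule k A →+ M :=
      { toFun := fun x => envL k ((toRegular k A).symm x) • m
        map_zero' := by rw [map_zero, envL, TensorProduct.zero_tmul]; exact zero_smul (Env k A) m
        map_add' := fun x y => by
          rw [← add_smul, ← TensorProduct.add_tmul, map_add] }
    have hf₀ : ∀ x : A, f₀ (toRegular k A x) = envL k x • m := fun _ => rfl
    let f : regularBimodule k A ⟶ M := homOfSmul f₀ <| map_smul_of_tmul f₀ fun a b x => by
      obtain ⟨x, rfl⟩ := (toRegular k A).surjective x
      obtain ⟨b, rfl⟩ := op_surjective b
      have h1 : envL k (a * x * b) = envL k (a * x) * envL k b := by simp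
      have h2 : (a ⊗ₜ op b : Env k A) * envL k x = envL k (a * x) * envR k b := by simp
      rw [smul_toRegular, hf₀, hf₀, smul_smul, h1, h2, mul_smul, mul_smul,
        envL_smul_of_invariant M m hm]
    refine ⟨f, ?_⟩
    ext r
    obtain ⟨r, rfl⟩ := (toTrivialLeft k A).surjective r
    change envL k ((toRegular k A).symm (toRegular k A (algebraMap k A r))) • m = _
    rw [hk, AddEquiv.symm_apply_apply]
    rfl

/-- Hochschild cohomology of a Hopf algebra is computed by `Ext` groups over the algebra. -/
theorem extTransfer_adjointUnit_bijective (M : ModuleCat.{u} (Env k A)) (n : ℕ) :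
    Function.Bijective (extTransfer.{u, u} (adjointRes k A) (adjointUnit k A) M n) :=
  extTransfer_bijective _ _ (adjointUnit_bijective k A) M n

end Hochschild

/-! ## The adjoint module of the enveloping algebra -/

section AdjointFree

open Abelian WithConv Coalgebra

theorem comp_mk₀_sum {R ι : Type u} [Ring R] {X Y Z : ModuleCat.{u} R} {n : ℕ}
    (x : Ext.{u} X Y n) (S : Finset ι) (f : ι → (Y ⟶ Z)) :
    x.comp (Ext.mk₀ (∑ s ∈ S, f s)) (add_zero n) =
      ∑ s ∈ S, x.comp (Ext.mk₀ (f s)) (add_zero n) := by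
  classical
  induction S using Finset.induction_on with
  | empty => rw [Finset.sum_empty, Finset.sum_empty, Ext.mk₀_zero, Ext.comp_zero]
  | insert s S hs h =>
    rw [Finset.sum_insert hs, Finset.sum_insert hs, Ext.mk₀_add, Ext.comp_add, h]

variable (k A : Type u) [Field k] [Ring A] [HopfAlgebra k A]

/-- The enveloping algebra as a left `A`-module through `diag`. -/
abbrev adjointEnv : ModuleCat.{u} A := (adjointRes k A).obj (ModuleCat.of (Env k A) (Env k A))

variable {A}

/-- The map `x ↦ diag x * (1 ⊗ op y)`. -/
def adjointMul (y : A) : ModuleCat.of A A ⟶ adjointEnv k A :=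
  homOfSmul (M := ModuleCat.of A A) (N := adjointEnv k A)
    ((AddMonoidHom.mulRight (envR k y)).comp (diag k A).toRingHom.toAddMonoidHom) fun a x => by
      change diag k A (a * x) * envR k y = diag k A a * (diag k A x * envR k y)
      rw [map_mul, mul_assoc]

theorem adjointMul_add (y z : A) : adjointMul k (y + z) = adjointMul k y + adjointMul k z := by
  ext
  change diag k A 1 * envR k (y + z) = diag k A 1 * envR k y + diag k A 1 * envR k z
  rw [← mul_add, envR, MulOpposite.op_add, TensorProduct.tmul_add]

theorem mk₀_adjointMul_smul (r : k) (y : A) :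
    Ext.mk₀ (adjointMul k (r • y)) = r • Ext.mk₀ (adjointMul k y) :=
  mk₀_smul_hom _ _ r fun x => by
    change diag k A x * envR k (r • y) = diag k A (algebraMap k A r) * (diag k A x * envR k y)
    rw [AlgHom.commutes, envR, op_smul, TensorProduct.tmul_smul, mul_smul_comm]
    exact Algebra.smul_def (A := Env k A) _ _

/-- A map out of A is determined at 1, where the left side is c ⊗ op (by); `tmul_eq_sum_diag`
expands this element. -/
theorem adjointMul_comp_rightMul (y b c : A) :
    adjointMul k y ≫ (adjointRes k A).map (rightMul (c ⊗ₜ[k] op b)) =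
      ∑ i ∈ (ℛ k c).index, rightMul ((ℛ k c).left i) ≫ adjointMul k
        (b * y * HopfAlgebra.antipode k (HopfAlgebra.antipode k ((ℛ k c).right i))) := by
  ext
  have h : (adjointMul k y ≫ (adjointRes k A).map (rightMul (c ⊗ₜ[k] op b))).hom (1 : A) =
      c ⊗ₜ[k] op (b * y) := by
    change diag k A 1 * envR k y * (c ⊗ₜ[k] op b) = _
    simp
  refine h.trans ?_
  rw [tmul_eq_sum_diag, ModuleCat.hom_sum, LinearMap.sum_apply]
  refine Finset.sum_congr rfl fun i _ => ?_
  change _ = diag k A (1 * (ℛ k c).left i) * _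
  rw [one_mul]

/-! ### Coordinates on the adjoint module of Aᵉ -/

section Basis

variable {k} {ι : Type u} [DecidableEq ι] (b : Module.Basis ι k A)

/-- Coordinates on the enveloping algebra with respect to `diag` and a basis of `A`. -/
def adjointCoord : Env k A ≃ₗ[k] (ι →₀ A) :=
  (diagLeft k A).symm.trans
    (TensorProduct.equivFinsuppOfBasisRight (b.map (opLinearEquiv k)))

theorem adjointCoord_apply (x y : A) (s : ι) :
    adjointCoord b (diag k A x * envR k y) s = b.repr y s • x := by
  rw [adjointCoord, LinearEquiv.trans_apply, ← diagLeft_tmul, LinearEquiv.symm_apply_apply,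
    TensorProduct.equivFinsuppOfBasisRight_apply_tmul_apply]
  simp

theorem adjointCoord_diag_mul (a : A) (z : Env k A) :
    adjointCoord b (diag k A a * z) = a • adjointCoord b z := by
  obtain ⟨t, rfl⟩ := (diagLeft k A).surjective z
  induction t using TensorProduct.induction_on with
  | zero => simp
  | add t t' ht ht' => rw [map_add, mul_add, map_add, map_add, ht, ht', smul_add]
  | tmul x y =>
    obtain ⟨y, rfl⟩ := op_surjective y
    ext s
    rw [diagLeft_tmul, ← mul_assoc, ← map_mul, adjointCoord_apply, Finsupp.smul_apply,
      adjointCoord_apply, smul_eq_mul, mul_smul_comm]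

/-- The adjoint module of the enveloping algebra is free. -/
def adjointFreeIso : adjointEnv k A ≅ ModuleCat.of A (ι →₀ A) :=
  isoOfSmul (M := adjointEnv k A) (N := ModuleCat.of A (ι →₀ A)) (adjointCoord b).toAddEquiv
    (adjointCoord_diag_mul b)

/-- A coordinate of the adjoint module of the enveloping algebra. -/
def adjointProj (s : ι) : adjointEnv k A ⟶ ModuleCat.of A A :=
  (adjointFreeIso b).hom ≫ ModuleCat.ofHom (Finsupp.lapply s)

/-- The coordinate of x ↦ δ(x)(1 ⊗ op y) at s is multiplication by the scalar coordinate of y, so on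
`Ext` it merely rescales classes. -/
theorem mk₀_adjointMul_adjointProj (y : A) (s : ι) :
    Ext.mk₀ (adjointMul k y ≫ adjointProj b s) =
      b.repr y s • Ext.mk₀ (𝟙 (ModuleCat.of A A)) :=
  mk₀_smul_hom _ _ _ fun x => by
    refine (adjointCoord_apply b x y s).trans ?_
    exact Algebra.smul_def _ _

theorem lsingle_adjointFreeIso (s : ι) :
    ModuleCat.ofHom (Finsupp.lsingle s) ≫ (adjointFreeIso b).inv = adjointMul k (b s) := by
  rw [Iso.comp_inv_eq]
  apply ModuleCat.hom_ext
  apply LinearMap.ext_ring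
  apply Finsupp.ext
  intro t
  refine Eq.trans ?_ (adjointCoord_apply b 1 (b s) t).symm
  simp only [ModuleCat.hom_ofHom, Finsupp.lsingle_apply, Finsupp.single_apply,
    Module.Basis.repr_self, ite_smul, one_smul, zero_smul]

variable [IsNoetherianRing A]

/-- Finite support of `Ext` classes in free modules, carried to ad Aᵉ: each class is the finite sum
of its coordinates, which lie in Extⁿ(X, A). -/
theorem exists_eq_sum_adjointMul (X : ModuleCat.{u} A) [Module.Finite A X] {n : ℕ}
    (x : Ext.{u} X (adjointEnv k A) n) : ∃ S : Finset ι, x = ∑ s ∈ S,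
      (x.comp (Ext.mk₀ (adjointProj b s)) (add_zero n)).comp (Ext.mk₀ (adjointMul k (b s)))
        (add_zero n) := by
  obtain ⟨S, hS⟩ := exists_truncSum_eq n X (x.comp (Ext.mk₀ (adjointFreeIso b).hom) (add_zero n))
  refine ⟨S, ?_⟩
  have h := congr(Ext.comp $hS (Ext.mk₀ (adjointFreeIso b).inv) (add_zero n))
  rw [Ext.comp_assoc_of_third_deg_zero, Ext.comp_assoc_of_third_deg_zero,
    Ext.comp_assoc_of_third_deg_zero, Ext.mk₀_comp_mk₀, Ext.mk₀_comp_mk₀, Ext.mk₀_comp_mk₀,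
    Iso.hom_inv_id, Ext.comp_mk₀_id] at h
  conv_lhs => rw [← h]
  rw [truncSum, Preadditive.sum_comp, Preadditive.comp_sum, comp_mk₀_sum]
  refine Finset.sum_congr rfl fun s _ => ?_
  rw [Ext.comp_assoc_of_third_deg_zero, Ext.mk₀_comp_mk₀, Category.assoc, lsingle_adjointFreeIso,
    adjointProj, Category.assoc]

end Basis

/-! ### `Ext` into Aᵉ from a single class with values in A -/

section Theta

variable {k} {X : ModuleCat.{u} A} {n : ℕ} (e : Ext.{u} X (ModuleCat.of A A) n)

/-- The map `A → Extⁿ(X, Aᵉ)` induced by an element of `Extⁿ(X, A)`. -/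
def adjointClass : A →ₗ[k] Ext.{u} X (adjointEnv k A) n where
  toFun y := e.comp (Ext.mk₀ (adjointMul k y)) (add_zero n)
  map_add' y z := by rw [adjointMul_add, Ext.mk₀_add, Ext.comp_add]
  map_smul' r y := by rw [mk₀_adjointMul_smul, Ext.comp_smul, RingHom.id_apply]

theorem adjointClass_apply (y : A) :
    adjointClass e y = e.comp (Ext.mk₀ (adjointMul k y)) (add_zero n) := rfl

/-- Projecting to the coordinate s returns e scaled by the coordinate of y, so every coordinate of y
is zero when the class is. -/
theorem adjointClass_injective (he : e ≠ 0) : Function.Injective (adjointClass (k := k) e) := by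
  classical
  rw [← LinearMap.ker_eq_bot, LinearMap.ker_eq_bot']
  intro y hy
  let b := Module.Basis.ofVectorSpace k A
  refine b.ext_elem fun s => ?_
  have h := congr(Ext.comp $hy (Ext.mk₀ (adjointProj b s)) (add_zero n))
  rw [adjointClass_apply, Ext.comp_assoc_of_third_deg_zero, Ext.mk₀_comp_mk₀,
    mk₀_adjointMul_adjointProj, Ext.comp_smul, Ext.comp_mk₀_id, Ext.zero_comp] at h
  rw [(smul_eq_zero.1 h).resolve_right he]
  simp

/-- Each of the finitely many coordinates of a class is a scalar multiple of e; those scalars are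
the coordinates of a preimage. -/
theorem adjointClass_surjective [IsNoetherianRing A] [Module.Finite A X]
    (he : ∀ x : Ext.{u} X (ModuleCat.of A A) n, ∃ r : k, r • e = x) :
    Function.Surjective (adjointClass (k := k) e) := by
  classical
  intro x
  let b := Module.Basis.ofVectorSpace k A
  obtain ⟨S, hS⟩ := exists_eq_sum_adjointMul b X x
  choose r hr using he
  refine ⟨∑ s ∈ S, r (x.comp (Ext.mk₀ (adjointProj b s)) (add_zero n)) • b s, ?_⟩
  rw [map_sum]
  conv_rhs => rw [hS]
  refine Finset.sum_congr rfl fun s _ => ?_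
  conv_rhs => rw [← hr (x.comp _ _)]
  rw [map_smul, adjointClass_apply, Ext.smul_comp]

theorem subsingleton_ext_adjointEnv [IsNoetherianRing A] [Module.Finite A X]
    [Subsingleton (Ext.{u} X (ModuleCat.of A A) n)] :
    Subsingleton (Ext.{u} X (adjointEnv k A) n) := by
  classical
  refine subsingleton_of_forall_eq 0 fun x => ?_
  obtain ⟨S, hS⟩ := exists_eq_sum_adjointMul (Module.Basis.ofVectorSpace k A) X x
  rw [hS]
  refine Finset.sum_eq_zero fun s _ => ?_
  rw [Subsingleton.elim (x.comp _ _) 0, Ext.zero_comp]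

/-- The Nakayama automorphism appears here: in the expansion of c ⊗ op (by), the factors c₁ act on e
by π(c₁), and the remaining sum ∑ π(c₁)S²c₂ is ξ(S²c). -/
theorem adjointClass_comp_rightMul (π : A →ₐ[k] k)
    (he : ∀ c, e.comp (Ext.mk₀ (rightMul c)) (add_zero n) = π c • e) (y b c : A) :
    (adjointClass e y).comp (Ext.mk₀ ((adjointRes k A).map (rightMul (c ⊗ₜ[k] op b))))
        (add_zero n) =
      adjointClass e (b * y *
        leftWindingHom π (HopfAlgebra.antipode k (HopfAlgebra.antipode k c))) := by
  rw [adjointClass_apply, Ext.comp_assoc_of_third_deg_zero, Ext.mk₀_comp_mk₀,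
    adjointMul_comp_rightMul, leftWindingHom_antipode_antipode, Finset.mul_sum, comp_mk₀_sum, map_sum]
  refine Finset.sum_congr rfl fun i _ => ?_
  rw [← Ext.mk₀_comp_mk₀, ← Ext.comp_assoc_of_third_deg_zero, he, Ext.smul_comp, mul_smul_comm,
    map_smul, adjointClass_apply]

end Theta

end AdjointFree

/-! ## The rigid Gorenstein property and the left integral -/

section Rigid

open Abelian WithConv Coalgebra

variable {k A : Type u} [Field k] [Ring A] [HopfAlgebra k A]

instance : Module.Finite A (trivialLeft k A) :=
  ⟨{toTrivialLeft k A 1}, by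
    rw [Finset.coe_singleton, eq_top_iff]
    intro x _
    obtain ⟨x, rfl⟩ := (toTrivialLeft k A).surjective x
    refine Submodule.mem_span_singleton.2 ⟨algebraMap k A x, ?_⟩
    rw [smul_toTrivialLeft, Bialgebra.counit_algebraMap, mul_one]⟩

/-- The element a - π(a) lies in the kernel of π, hence annihilates M. So the character defined by
its kernel really gives the action. -/
theorem op_smul_eq_of_character {M : Type u} [AddCommGroup M] [Module k M] [Module Aᵐᵒᵖ M]
    [IsScalarTower k Aᵐᵒᵖ M] (π : A →ₐ[k] k) (hπ : ∀ a, π a = 0 ↔ ∀ x : M, op a • x = 0)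
    (a : A) (x : M) : op a • x = π a • x := by
  have h := (hπ (a - algebraMap k A (π a))).1
    (by rw [map_sub, AlgHom.commutes, Algebra.algebraMap_self_apply, sub_self]) x
  rw [MulOpposite.op_sub, sub_smul, sub_eq_zero] at h
  exact h.trans (algebraMap_smul Aᵐᵒᵖ (π a) x)

theorem mulExt_eq_smul {P : ModuleCat.{u} (Env k A)} {i : ℕ} (a : A) (r : k)
    (hr : ∀ p : P, envR k a • p = envL k (algebraMap k A r) • p)
    (x : Ext.{u} ((resLeft k A).obj P) (ModuleCat.of A A) i) : mulExt a x = r • x := by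
  have h : Ext.mk₀ ((actRight (k := k) (B := A) (op a)).app P) =
      r • Ext.mk₀ (𝟙 ((resLeft k A).obj P)) :=
    mk₀_smul_hom _ _ r hr
  rw [mulExt, h, Ext.smul_comp, Ext.mk₀_id_comp]

/-! ### The two actions on the left integral -/

section Integral

variable {d : ℕ} (h : IsASGorenstein k A (Bialgebra.counitAlgHom k A) d)

theorem extMul_eq_integralCharacter_smul
    (x : Ext.{u} (trivialLeft k A) (ModuleCat.of A A) d) (c : A) :
    x.comp (Ext.mk₀ (rightMul c)) (add_zero d) = integralCharacter h c • x :=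
  op_smul_eq_of_character (M := ExtRing (trivialLeft k A) d) (integralCharacter h)
    (existsUnique_character (A := A) h.finrank_left).choose_spec.1 c x

theorem mulExt_eq_counit_smul (x : Ext.{u} (trivialLeft k A) (ModuleCat.of A A) d) (a : A) :
    mulExt (P := trivialBimodule (Bialgebra.counitAlgHom k A)) a x = counit (R := k) a • x := by
  refine mulExt_eq_smul a (counit (R := k) a) (fun p => ?_) x
  obtain ⟨y, rfl⟩ := (toTrivial (Bialgebra.counitAlgHom k A)).surjective p
  rw [envR, envL, smul_toTrivial, ← op_one, smul_toTrivial]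
  simp

/-- ε(∑ π(a₁)a₂) = π(∑ a₁ε(a₂)) = π(a). -/
theorem counit_leftWindingHom (π : A →ₐ[k] k) (a : A) :
    counit (R := k) (leftWindingHom π a) = π a := by
  have h := congr(LinearMap.mul' k k $(Coalgebra.sum_map_tmul_counit_eq π a (repr := ℛ k a)))
  rw [leftWindingHom_eq_sum, map_sum]
  simpa only [map_sum, LinearMap.mul'_apply, map_smul, smul_eq_mul, mul_one] using h

/-- The antipode preserves the counit, so S² changes nothing in the previous computation; hence ν
and ξ twist the trivial bimodule identically. -/
theorem counit_leftWindingHom_antipode (π : A →ₐ[k] k) (a : A) : counit (R := k)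
    (leftWindingHom π (HopfAlgebra.antipode k (HopfAlgebra.antipode k a))) = π a := by
  rw [leftWindingHom_antipode_antipode, ← counit_leftWindingHom, leftWindingHom_eq_sum,
    map_sum, map_sum]
  simp only [map_smul, HopfAlgebra.counit_antipode]

/-- The left integral as a twisted trivial bimodule. -/
theorem leftIntegral_iso_twist (τ : A ≃ₐ[k] A)
    (hτ : ∀ a, counit (R := k) (τ a) = integralCharacter h a) :
    Nonempty (leftIntegral (Bialgebra.counitAlgHom k A) d ≅
      twist AlgEquiv.refl τ (trivialBimodule (Bialgebra.counitAlgHom k A))) := by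
  obtain ⟨e, he0, he⟩ := finrank_eq_one_iff'.1 h.finrank_left
  let κ₀ : k →+ ExtRing (trivialLeft k A) d := (AddMonoidHom.flip (smulAddHom k _)) e
  let κ : k ≃+ ExtRing (trivialLeft k A) d := AddEquiv.ofBijective κ₀
    ⟨smul_left_injective k he0, he⟩
  let κ' : twist AlgEquiv.refl τ (trivialBimodule (Bialgebra.counitAlgHom k A)) ≃+
    leftIntegral (Bialgebra.counitAlgHom k A) d :=
      ((toTwist AlgEquiv.refl τ _).symm.trans (toTrivial _).symm).trans κ
  refine ⟨(isoOfSmul κ' (map_smul_of_tmul κ'.toAddMonoidHom fun a b x => ?_)).symm⟩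
  obtain ⟨x, rfl⟩ := (toTwist AlgEquiv.refl τ _).surjective x
  obtain ⟨x, rfl⟩ := (toTrivial _).surjective x
  obtain ⟨b, rfl⟩ := op_surjective b
  rw [smul_toTwist, smul_toTrivial]
  refine Eq.trans ?_ ((mulExt_eq_counit_smul (extMul (κ x) b) a).trans
    (congrArg (counit (R := k) a • ·) (extMul_eq_integralCharacter_smul h (κ x) b))).symm
  change (_ * _ * x) • e = counit a • integralCharacter h b • x • e
  rw [← hτ]
  exact (mul_smul (counit (R := k) a * counit (τ b)) x e).trans
    (mul_smul (counit (R := k) a) (counit (τ b)) (x • e))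

end Integral

/-- Θ is `adjointClass` of a generator of the integral, carried back through the comparison with
Ext_A(k, -). Recording the full right Aᵉ-action lets the same Θ serve both the rigid Gorenstein
property and the rigidity of R. -/
theorem exists_hochschild_equiv {d : ℕ} [IsNoetherianRing A]
    (hS : Function.Bijective (HopfAlgebra.antipode k (A := A)))
    (h : IsASGorenstein k A (Bialgebra.counitAlgHom k A) d) :
    ∃ Θ : A ≃+ Ext.{u} (regularBimodule k A) (ModuleCat.of (Env k A) (Env k A)) d,
      ∀ y b c, (Θ y).comp (Ext.mk₀ (rightMul (c ⊗ₜ[k] op b))) (add_zero d) =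
        Θ (b * y * nakayamaAut hS h c) := by
  obtain ⟨e, he0, he⟩ := finrank_eq_one_iff'.1 h.finrank_left
  let T := AddEquiv.ofBijective _
    (extTransfer_adjointUnit_bijective k A (ModuleCat.of (Env k A) (Env k A)) d)
  let Θ := AddEquiv.ofBijective (adjointClass (k := k) (A := A) e).toAddMonoidHom
    ⟨adjointClass_injective e he0, adjointClass_surjective e he⟩
  refine ⟨Θ.trans T.symm, fun y b c => T.injective ?_⟩
  change extTransfer _ _ _ d _ = T _
  rw [extTransfer_comp, Ext.mapExactFunctor_mk₀]
  change (T (T.symm (Θ y))).comp _ _ = T (T.symm (Θ _))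
  rw [T.apply_symm_apply, T.apply_symm_apply]
  exact adjointClass_comp_rightMul e (integralCharacter h)
    (extMul_eq_integralCharacter_smul h e) y b c

theorem subsingleton_hochschild {d : ℕ} [IsNoetherianRing A]
    (h : IsASGorenstein k A (Bialgebra.counitAlgHom k A) d) (i : ℕ) (hi : i ≠ d) :
    Subsingleton (Ext.{u} (regularBimodule k A) (ModuleCat.of (Env k A) (Env k A)) i) := by
  have : Subsingleton (Ext.{u} (trivialLeft k A) (ModuleCat.of A A) i) := h.vanish_left i hi
  have := subsingleton_ext_adjointEnv (k := k) (A := A) (X := trivialLeft k A) (n := i)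
  exact (extTransfer_adjointUnit_bijective k A
    (ModuleCat.of (Env k A) (Env k A)) i).injective.subsingleton

theorem isRigidGorenstein {d : ℕ} [IsNoetherianRing A]
    (hS : Function.Bijective (HopfAlgebra.antipode k (A := A)))
    (h : IsASGorenstein k A (Bialgebra.counitAlgHom k A) d) :
    IsRigidGorenstein k A d (nakayamaAut hS h) where
  injDim := ⟨h.injDim_left, h.injDim_right⟩
  vanish := subsingleton_hochschild h
  iso := by
    obtain ⟨Θ, hΘ⟩ := exists_hochschild_equiv hS h
    let κ : twist AlgEquiv.refl (nakayamaAut hS h) (regularBimodule k A) ≃+ hochschildExt k A d :=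
      ((toTwist AlgEquiv.refl (nakayamaAut hS h) _).symm.trans (toRegular k A).symm).trans Θ
    refine ⟨(isoOfSmul κ (map_smul_of_tmul κ.toAddMonoidHom fun a b x => ?_)).symm⟩
    obtain ⟨x, rfl⟩ := (toTwist AlgEquiv.refl _ _).surjective x
    obtain ⟨x, rfl⟩ := (toRegular k A).surjective x
    obtain ⟨b, rfl⟩ := op_surjective b
    rw [smul_toTwist, smul_toRegular]
    -- The flip turns a ⊗ op b into right multiplication by b ⊗ op a, so Θ(x) goes to Θ(a x ν(b)).
    refine (hΘ x a b).symm.trans ?_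
    change _ = Ext.comp (Θ x) (Ext.mk₀ (rightMul (unop (envFlip k A (a ⊗ₜ op b))))) (add_zero d)
    rw [envFlip_tmul]
    rfl

end Rigid

/-! ## Computation of derived `Hom` complexes -/

section DerivedHom

attribute [local instance] HasDerivedCategory.standard

variable {k : Type u} [Field k] {B C : Type u} [Ring B] [Algebra k B] [Ring C] [Algebra k C]

/-- The derived `Hom` complex is computed by a bounded below complex of injective modules. -/
theorem nonempty_rHom_iso (X : ModuleCat.{u} B) (M : CochainComplex.Plus (ModuleCat.{u} (B ⊗[k] C)))
    (J : CochainComplex (ModuleCat.{u} (B ⊗[k] C)) ℤ) [∀ n, Injective (J.X n)]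
    (hJ : CochainComplex.plus _ J) (f : M.obj ⟶ J) [QuasiIso f] :
    Nonempty (rHom k C X M ≅ DerivedCategory.Q.obj
      (((homFunctor k C X).mapHomologicalComplex (ComplexShape.up ℤ)).obj J)) := by
  let J' : CochainComplex.Plus (ModuleCat.{u} (B ⊗[k] C)) := ⟨J, hJ⟩
  have : ∀ n, Injective (J'.obj.X n) := fun n => inferInstanceAs (Injective (J.X n))
  let e₀ : DerivedCategory.Q.obj M.obj ≅ DerivedCategory.Q.obj J := asIso (DerivedCategory.Q.map f)
  let e : DerivedCategory.Plus.Q.obj M ≅ DerivedCategory.Plus.Q.obj J' :=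
    DerivedCategory.Plus.ι.preimageIso e₀
  let e' := asIso ((homFunctor k C X).rightDerivedFunctorPlusUnit.app
    ((HomotopyCategory.Plus.quotient _).obj J'))
  exact ⟨DerivedCategory.Plus.ι.mapIso
    ((homFunctor k C X).rightDerivedFunctorPlus.mapIso e ≪≫ e'.symm)⟩

end DerivedHom

/-! ### Recognising a complex from its cohomology -/

section Homology

/-- A description of the homology of a short complex of modules. -/
theorem nonempty_homology_iso {R : Type u} [Ring R] (S : ShortComplex (ModuleCat.{u} R))
    (N : ModuleCat.{u} R) (p : LinearMap.ker S.g.hom →ₗ[R] N) (hp : Function.Surjective p)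
    (hp' : ∀ z, p z = 0 ↔ ∃ y, S.f.hom y = z) : Nonempty (S.homology ≅ N) := by
  have h : LinearMap.ker p = LinearMap.range S.moduleCatToCycles := by
    ext z
    rw [LinearMap.mem_ker, hp', LinearMap.mem_range]
    exact exists_congr fun y => (Subtype.ext_iff (a1 := S.moduleCatToCycles y) (a2 := z)).symm
  exact ⟨S.moduleCatHomologyIso ≪≫ LinearEquiv.toModuleIso
    ((Submodule.quotEquivOfEq _ _ h.symm).trans (p.quotKerEquivOfSurjective hp))⟩

variable {C : Type*} [Category* C] [Abelian C]

attribute [local instance] HasDerivedCategory.standard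

/-- Objects of the derived category with isomorphic cohomology concentrated in one degree are
isomorphic. -/
theorem nonempty_iso_single (K : CochainComplex C ℤ) (n : ℤ) (N : C)
    (h : ∀ i, i ≠ n → Limits.IsZero (K.homology i)) (e : Nonempty (K.homology n ≅ N)) :
    Nonempty (DerivedCategory.Q.obj K ≅
      DerivedCategory.Q.obj ((CochainComplex.singleFunctor C n).obj N)) := by
  have : K.IsGE n := (CochainComplex.isGE_iff _ _).2 fun i hi =>
    (HomologicalComplex.exactAt_iff_isZero_homology _ _).2 (h i hi.ne)
  have : K.IsLE n := (CochainComplex.isLE_iff _ _).2 fun i hi =>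
    (HomologicalComplex.exactAt_iff_isZero_homology _ _).2 (h i hi.ne')
  obtain ⟨Y, ⟨f⟩⟩ := (DerivedCategory.Q.obj K).exists_iso_singleFunctor_obj_of_isGE_of_isLE n
  obtain ⟨e⟩ := e
  let g : Y ≅ N := ((DerivedCategory.singleFunctorCompHomologyFunctorIso C n).app Y).symm ≪≫
    (DerivedCategory.homologyFunctor C n).mapIso f.symm ≪≫
    (DerivedCategory.homologyFunctorFactors C n).app K ≪≫ e
  exact ⟨f ≪≫ (DerivedCategory.singleFunctor C n).mapIso g ≪≫
    (DerivedCategory.singleFunctorIsoCompQ C n).app N⟩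

end Homology

/-! ## Injective resolutions and exact functors -/

section MapInjectiveResolution

universe v v' u₁ u₂

open Limits

variable {C : Type u₁} [Category.{v} C] [Abelian C] {D : Type u₂} [Category.{v'} D] [Abelian D]

/-- The image of an injective resolution under an exact functor which preserves injectives. -/
def mapInjectiveResolution (F : C ⥤ D) [F.Additive] [F.PreservesInjectiveObjects]
    [F.PreservesHomology] {Z : C} (I : InjectiveResolution Z) :
    InjectiveResolution (F.obj Z) where
  cocomplex := (F.mapHomologicalComplex _).obj I.cocomplex
  injective n := Functor.PreservesInjectiveObjects.injective_obj (I.injective n)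
  ι := (HomologicalComplex.singleMapHomologicalComplex F (ComplexShape.up ℕ) 0).inv.app Z ≫
    (F.mapHomologicalComplex _).map I.ι
  quasiIso := by
    have : QuasiIso ((F.mapHomologicalComplex (ComplexShape.up ℕ)).map I.ι) :=
      HomologicalComplex.quasiIso_map_of_preservesHomology _ _
    infer_instance

/-- The endomorphism of the image of an injective resolution given by a natural transformation. -/
def mapInjectiveResolutionHom {F G : C ⥤ D} [F.Additive] [F.PreservesInjectiveObjects]
    [F.PreservesHomology] [G.Additive] [G.PreservesInjectiveObjects] [G.PreservesHomology]
    (α : F ⟶ G) {Z : C} (I : InjectiveResolution Z) :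
    InjectiveResolution.Hom (mapInjectiveResolution F I) (mapInjectiveResolution G I)
      (α.app Z) where
  hom := (NatTrans.mapHomologicalComplex α (ComplexShape.up ℕ)).app I.cocomplex
  ι_f_zero_comp_hom_f_zero := by
    have h := α.naturality (I.ι.f 0)
    have h1 : (mapInjectiveResolution F I).ι.f 0 = F.map (I.ι.f 0) := by
      simp [mapInjectiveResolution]
      exact Category.id_comp _
    have h2 : (mapInjectiveResolution G I).ι.f 0 = G.map (I.ι.f 0) := by
      simp [mapInjectiveResolution]
      exact Category.id_comp _
    rw [h1, h2, CochainComplex.single₀_map_f_zero]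
    exact h

end MapInjectiveResolution

/-! ### `Ext` classes represented by cocycles -/

section ExtCocycles

open Limits Abelian CochainComplex HomComplex

universe w v u₁

variable {C : Type u₁} [Category.{v} C] [Abelian C] {X Y : C}
  (R : InjectiveResolution Y)

theorem extMk_eq_zero_iff_exists [HasExt.{w} C] {n : ℕ} (f : X ⟶ R.cocomplex.X n) (m : ℕ) (hm : n + 1 = m)
    (hf : f ≫ R.cocomplex.d n m = 0) (p : ℤ) (hp : p + 1 = n) :
    R.extMk f m hm hf = 0 ↔
      ∃ g : X ⟶ R.cochainComplex.X p,
        g ≫ R.cochainComplex.d p n = f ≫ (R.cochainComplexXIso n n rfl).inv := by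
  rw [← R.extEquivCohomologyClass.apply_eq_iff_eq,
    InjectiveResolution.extEquivCohomologyClass_extMk,
    InjectiveResolution.extEquivCohomologyClass_zero, CohomologyClass.mk_eq_zero_iff,
    Cocycle.fromSingleMk_mem_coboundaries_iff _ _ _ _ _ p hp]

variable {E : Type*} [Category* E] [Abelian E]

section

variable (F : E ⥤ C) [F.Additive] [F.PreservesInjectiveObjects] [F.PreservesHomology] {Z : E}
  (I : InjectiveResolution Z) {n : ℕ}

/-- The comparison of the terms of an injective resolution indexed by `ℕ` and by `ℤ`, after
applying a functor. -/
def mapXIso (n : ℕ) :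
    F.obj (I.cochainComplex.X n) ≅ (mapInjectiveResolution F I).cocomplex.X n :=
  F.mapIso (I.cochainComplexXIso n n rfl)

theorem mapXIso_hom_d (n m : ℕ) (p q : ℤ) (hp : n = p) (hq : m = q) :
    F.map (I.cochainComplex.d p q) ≫ F.map (I.cochainComplexXIso q m hq).hom =
      F.map (I.cochainComplexXIso p n hp).hom ≫
        (mapInjectiveResolution F I).cocomplex.d n m := by
  rw [I.cochainComplex_d p q n m hp hq, ← F.map_comp, Category.assoc, Category.assoc,
    Iso.inv_hom_id, Category.comp_id]
  exact F.map_comp _ _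

theorem comp_mapXIso_hom_d (f : X ⟶ F.obj (I.cochainComplex.X n))
    (hf : f ≫ F.map (I.cochainComplex.d n (n + 1)) = 0) :
    (f ≫ (mapXIso F I n).hom) ≫ (mapInjectiveResolution F I).cocomplex.d n (n + 1) = 0 := by
  have h : F.map (I.cochainComplex.d n (n + 1)) ≫ (mapXIso F I (n + 1)).hom =
      (mapXIso F I n).hom ≫ _ := mapXIso_hom_d F I n (n + 1) n (n + 1) rfl rfl
  rw [Category.assoc, ← h, reassoc_of% hf, zero_comp]

/-- The class in `Ext^n(X, F Z)` of a cocycle with values in the image under `F` of an injective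
resolution of `Z`. -/
def extOfCocycle [HasExt.{w} C] (f : X ⟶ F.obj (I.cochainComplex.X n))
    (hf : f ≫ F.map (I.cochainComplex.d n (n + 1)) = 0) : Ext.{w} X (F.obj Z) n :=
  (mapInjectiveResolution F I).extMk (f ≫ (mapXIso F I n).hom) (n + 1) rfl
    (comp_mapXIso_hom_d F I f hf)

theorem extOfCocycle_add [HasExt.{w} C] (f g : X ⟶ F.obj (I.cochainComplex.X n))
    (hf : f ≫ F.map (I.cochainComplex.d n (n + 1)) = 0)
    (hg : g ≫ F.map (I.cochainComplex.d n (n + 1)) = 0)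
    (hfg : (f + g) ≫ F.map (I.cochainComplex.d n (n + 1)) = 0) :
    extOfCocycle.{w} F I (f + g) hfg = extOfCocycle F I f hf + extOfCocycle F I g hg := by
  rw [extOfCocycle, extOfCocycle, extOfCocycle, InjectiveResolution.add_extMk]
  congr 1
  exact Preadditive.add_comp _ _ _ _ _ _

theorem extOfCocycle_surjective [HasExt.{w} C] (x : Ext.{w} X (F.obj Z) n) :
    ∃ (f : X ⟶ F.obj (I.cochainComplex.X n))
      (hf : f ≫ F.map (I.cochainComplex.d n (n + 1)) = 0), extOfCocycle F I f hf = x := by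
  obtain ⟨f, hf, rfl⟩ := (mapInjectiveResolution F I).extMk_surjective x (n + 1) rfl
  have h : F.map (I.cochainComplex.d n (n + 1)) ≫ (mapXIso F I (n + 1)).hom =
      (mapXIso F I n).hom ≫ _ := mapXIso_hom_d F I n (n + 1) n (n + 1) rfl rfl
  refine ⟨f ≫ (mapXIso F I n).inv, ?_, ?_⟩
  · rw [← cancel_mono (mapXIso F I (n + 1)).hom, Category.assoc, Category.assoc]
    refine Eq.trans (congrArg (f ≫ (mapXIso F I n).inv ≫ ·) h) ?_
    rw [Iso.inv_hom_id_assoc, hf, zero_comp]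
  · rw [extOfCocycle]
    congr 1
    rw [Category.assoc, Iso.inv_hom_id, Category.comp_id]

/-- The previous degree p is an integer so that the coboundary criterion also covers n = 0, as
needed for a complex indexed by ℤ. -/
theorem extOfCocycle_eq_zero_iff [HasExt.{w} C] (f : X ⟶ F.obj (I.cochainComplex.X n))
    (hf : f ≫ F.map (I.cochainComplex.d n (n + 1)) = 0) (p : ℤ) (hp : p + 1 = n) :
    extOfCocycle.{w} F I f hf = 0 ↔
      ∃ g : X ⟶ F.obj (I.cochainComplex.X p), g ≫ F.map (I.cochainComplex.d p n) = f := by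
  cases n with
  | zero =>
    -- For n = 0 the previous degree is -1, where the complexes vanish: being a coboundary means
    -- being zero.
    have h1 := (mapInjectiveResolution F I).cochainComplex.isZero_of_isStrictlyGE 0 p (by omega)
    have h2 := F.map_isZero (I.cochainComplex.isZero_of_isStrictlyGE 0 p (by omega))
    rw [extOfCocycle, extMk_eq_zero_iff_exists _ _ _ _ _ p hp]
    constructor
    · rintro ⟨g, hg⟩
      refine ⟨0, ?_⟩
      rw [h1.eq_of_tgt g 0, zero_comp, eq_comm, Preadditive.IsIso.comp_right_eq_zero,
        Preadditive.IsIso.comp_right_eq_zero] at hg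
      rw [hg, zero_comp]
    · rintro ⟨g, rfl⟩
      refine ⟨0, ?_⟩
      rw [h2.eq_of_tgt g 0, zero_comp, zero_comp, zero_comp, zero_comp]
  | succ m =>
    obtain rfl : p = m := by omega
    have h : F.map (I.cochainComplex.d m (m + 1 : ℕ)) ≫ (mapXIso F I (m + 1)).hom =
      (mapXIso F I m).hom ≫ _ :=
        mapXIso_hom_d F I m (m + 1) m ((m + 1 : ℕ) : ℤ) rfl rfl
    rw [extOfCocycle, InjectiveResolution.extMk_eq_zero_iff _ _ _ _ _ m rfl]
    constructor
    · rintro ⟨g, hg⟩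
      refine ⟨g ≫ (mapXIso F I m).inv, ?_⟩
      rw [← cancel_mono (mapXIso F I (m + 1)).hom, ← hg, Category.assoc, Category.assoc]
      refine (congrArg (g ≫ (mapXIso F I m).inv ≫ ·) h).trans ?_
      rw [Iso.inv_hom_id_assoc]
    · rintro ⟨g, rfl⟩
      refine ⟨g ≫ (mapXIso F I m).hom, ?_⟩
      rw [Category.assoc, Category.assoc]
      exact congrArg (g ≫ ·) h.symm

end

/-- A natural transformation lifts its value at Z to the mapped resolutions. Applied to the
commuting action, this makes the passage from cocycles to `Ext` linear over the second algebra. -/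
theorem extOfCocycle_comp_mk₀ [HasExt.{w} C] {F G : E ⥤ C} [F.Additive] [F.PreservesInjectiveObjects]
    [F.PreservesHomology] [G.Additive] [G.PreservesInjectiveObjects] [G.PreservesHomology]
    (α : F ⟶ G) {Z : E} (I : InjectiveResolution Z) {n : ℕ}
    (f : X ⟶ F.obj (I.cochainComplex.X n))
    (hf : f ≫ F.map (I.cochainComplex.d n (n + 1)) = 0)
    (hf' : (f ≫ α.app _) ≫ G.map (I.cochainComplex.d n (n + 1)) = 0) :
    (extOfCocycle.{w} F I f hf).comp (Ext.mk₀ (α.app Z)) (add_zero n) =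
      extOfCocycle G I (f ≫ α.app _) hf' := by
  rw [extOfCocycle, InjectiveResolution.extMk_comp_mk₀ _ _ _ _ (mapInjectiveResolutionHom α I)]
  rw [extOfCocycle]
  congr 1
  rw [Category.assoc, Category.assoc]
  exact congrArg (f ≫ ·) (α.naturality _)

end ExtCocycles

/-! ## The cohomology of the derived `Hom` complex -/

section HomHomology

open Abelian Limits

variable {k : Type u} [Field k] {B C : Type u} [Ring B] [Algebra k B] [Ring C] [Algebra k C]

variable (k B C) in
/-- The underlying `B`-module of a `B ⊗ C`-module. -/
abbrev resFst : ModuleCat.{u} (B ⊗[k] C) ⥤ ModuleCat.{u} B :=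
  ModuleCat.restrictScalars (Algebra.TensorProduct.includeLeft : B →ₐ[k] B ⊗[k] C).toRingHom

variable (X : ModuleCat.{u} B) {T : ModuleCat.{u} (B ⊗[k] C)} (I : InjectiveResolution T)

/-- The homology of the `Hom` complex into an injective resolution. -/
theorem nonempty_homology_homFunctor_iso (n : ℕ) (N : ModuleCat.{u} C)
    (θ : N ≃+ Ext.{u} X ((resFst k B C).obj T) n)
    (hθ : ∀ (c : C) (x : N),
      θ (c • x) = (θ x).comp (Ext.mk₀ ((actRight c).app T)) (add_zero n)) :
    Nonempty ((((homFunctor k C X).mapHomologicalComplex (ComplexShape.up ℤ)).obj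
      I.cochainComplex).homology n ≅ N) := by
  let L := ((homFunctor k C X).mapHomologicalComplex (ComplexShape.up ℤ)).obj I.cochainComplex
  let S := L.sc' (n - 1) n (n + 1)
  let e : L.homology n ≅ S.homology :=
    ShortComplex.homologyMapIso (L.isoSc' (n - 1) n (n + 1) (by simp) (by simp))
  -- A cycle of the `Hom` complex is a `B`-linear map into the n-th injective module that the
  -- differential kills; `p` sends it to its `Ext` class, read in N through θ.
  let cocyc : ∀ z : LinearMap.ker S.g.hom, ∃ f : X ⟶ (resFst k B C).obj (I.cochainComplex.X n),
      f = z.1 ∧ f ≫ (resFst k B C).map (I.cochainComplex.d n (n + 1)) = 0 :=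
    fun z => ⟨z.1, rfl, z.2⟩
  choose φ hφ hφ' using cocyc
  let p : LinearMap.ker S.g.hom →ₗ[C] N :=
    { toFun := fun z => θ.symm (extOfCocycle (resFst k B C) I (φ z) (hφ' z))
      map_add' := fun z w => by
        rw [← map_add, ← extOfCocycle_add _ _ _ _ _ _ (by
          rw [Preadditive.add_comp, hφ', hφ', add_zero])]
        congr 2
        exact (hφ _).trans
          (congrArg₂ (fun f g : X ⟶ (resFst k B C).obj _ => f + g) (hφ z) (hφ w)).symm
      map_smul' := fun c z => by
        apply θ.injective
        rw [RingHom.id_apply, hθ, θ.apply_symm_apply, θ.apply_symm_apply,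
          extOfCocycle_comp_mk₀ _ _ _ _ (by
            rw [Category.assoc, ← (actRight c).naturality, ← Category.assoc, hφ', zero_comp])]
        congr 1
        exact (hφ _).trans (congrArg (· ≫ (actRight c).app _) (hφ z)).symm }
  obtain ⟨f⟩ := nonempty_homology_iso S N p (fun x => by
    obtain ⟨f, hf, h⟩ := extOfCocycle_surjective (resFst k B C) I (θ x)
    refine ⟨⟨f, hf⟩, ?_⟩
    apply θ.injective
    change θ (θ.symm _) = _
    rw [θ.apply_symm_apply, ← h]
    congr 1
    exact hφ _) (fun z => by
    change θ.symm _ = 0 ↔ _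
    rw [map_eq_zero_iff _ θ.symm.injective,
      extOfCocycle_eq_zero_iff _ _ _ _ (n - 1) (sub_add_cancel _ _)]
    exact exists_congr fun g => by rw [hφ]; rfl)
  exact ⟨e ≪≫ f⟩

theorem isZero_homology_homFunctor (n : ℤ)
    (h : ∀ m : ℕ, (m : ℤ) = n → Subsingleton (Ext.{u} X ((resFst k B C).obj T) m)) :
    IsZero ((((homFunctor k C X).mapHomologicalComplex (ComplexShape.up ℤ)).obj
      I.cochainComplex).homology n) := by
  by_cases hn : 0 ≤ n
  · obtain ⟨m, rfl⟩ := Int.eq_ofNat_of_zero_le hn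
    -- In nonnegative degrees the homology is an `Ext` group, here compared with the zero module; in
    -- negative degrees the complex itself vanishes.
    have := h m rfl
    obtain ⟨e⟩ := nonempty_homology_homFunctor_iso X I m (ModuleCat.of C PUnit.{u + 1})
      { toFun := fun _ => 0
        invFun := fun _ => 0
        left_inv := fun _ => rfl
        right_inv := fun _ => Subsingleton.elim _ _
        map_add' := fun _ _ => Subsingleton.elim _ _ } (fun _ _ => Subsingleton.elim _ _)
    exact (ModuleCat.isZero_of_subsingleton _).of_iso e
  · have : CochainComplex.IsStrictlyGE (((homFunctor k C X).mapHomologicalComplex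
      (ComplexShape.up ℤ)).obj I.cochainComplex) 0 := inferInstance
    exact (CochainComplex.exactAt_of_isGE _ 0 n (by omega)).isZero_homology

end HomHomology

/-! ### Derived `Hom` with cohomology in one degree -/

section ConcentratedHom

open Abelian Limits

attribute [local instance] HasDerivedCategory.standard

variable {k : Type u} [Field k] {B C : Type u} [Ring B] [Algebra k B] [Ring C] [Algebra k C]

/-- The derived `Hom` complex into a module placed in one degree, when the `Ext` groups are
concentrated in one degree. -/
theorem nonempty_rHom_iso_single (X : ModuleCat.{u} B)
    (M : CochainComplex.Plus (ModuleCat.{u} (B ⊗[k] C))) (T : ModuleCat.{u} (B ⊗[k] C)) (m : ℤ)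
    (g : M.obj ≅ (CochainComplex.singleFunctor _ m).obj T) (d : ℕ) (N : ModuleCat.{u} C)
    (hd : ∀ i, i ≠ d → Subsingleton (Ext.{u} X ((resFst k B C).obj T) i))
    (θ : N ≃+ Ext.{u} X ((resFst k B C).obj T) d)
    (hθ : ∀ (c : C) (x : N),
      θ (c • x) = (θ x).comp (Ext.mk₀ ((actRight c).app T)) (add_zero d))
    (n : ℤ) (hn : n = m + d) :
    Nonempty (rHom k C X M ≅
      DerivedCategory.Q.obj ((CochainComplex.singleFunctor _ n).obj N)) := by
  subst hn
  let I : InjectiveResolution T := InjectiveResolution.of T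
  -- The resolution of T shifted by -m starts in degree m, so it resolves T placed there; its `Hom`
  -- complex has Ext^{i-m} as cohomology in degree i.
  let J := (shiftFunctor (CochainComplex (ModuleCat.{u} (B ⊗[k] C)) ℤ) (-m)).obj I.cochainComplex
  have : ∀ n, Injective (J.X n) := fun n =>
    inferInstanceAs (Injective (I.cochainComplex.X (n + -m)))
  have hJ : CochainComplex.plus _ J :=
    ⟨m, I.cochainComplex.isStrictlyGE_shift 0 (-m) m (by omega)⟩
  let f : M.obj ⟶ J := g.hom ≫
    ((CochainComplex.singleFunctors _).shiftIso (-m) m 0 (by omega)).inv.app T ≫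
      (shiftFunctor (CochainComplex (ModuleCat.{u} (B ⊗[k] C)) ℤ) (-m)).map I.ι'
  have h2 : QuasiIso ((shiftFunctor (CochainComplex (ModuleCat.{u} (B ⊗[k] C)) ℤ) (-m)).map
    I.ι') := (CochainComplex.quasiIso_shift_iff _ _).2 inferInstance
  have : QuasiIso f := by
    have : QuasiIso (((CochainComplex.singleFunctors _).shiftIso (-m) m 0 (by omega)).inv.app T ≫
      (shiftFunctor (CochainComplex (ModuleCat.{u} (B ⊗[k] C)) ℤ) (-m)).map I.ι') :=
        quasiIso_comp _ _
    exact quasiIso_comp _ _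
  let G := (homFunctor k C X).mapHomologicalComplex (ComplexShape.up ℤ)
  let e : ∀ i : ℤ, (G.obj J).homology i ≅ (G.obj I.cochainComplex).homology (i - m) := fun i =>
    (HomologicalComplex.homologyFunctor _ _ i).mapIso ((G.commShiftIso (-m)).app _) ≪≫
      (CochainComplex.ShiftSequence.shiftIso (ModuleCat.{u} C) (-m) i (i - m) (by omega)).app _
  obtain ⟨e'⟩ := nonempty_homology_homFunctor_iso X I d N θ hθ
  obtain ⟨r⟩ := nonempty_rHom_iso X M J hJ f
  obtain ⟨s⟩ := nonempty_iso_single (G.obj J) (m + d) N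
    (fun i hi => (isZero_homology_homFunctor X I (i - m) fun p hp =>
      hd p fun h => hi (by omega)).of_iso (e i))
    ⟨e _ ≪≫ eqToIso (by rw [add_sub_cancel_left]) ≪≫ e'⟩
  exact ⟨r ≪≫ s⟩

end ConcentratedHom

/-! ### Complexes concentrated in one degree and their tensor squares -/

section Concentrated

open Limits

/-- A complex concentrated in one degree. -/
theorem nonempty_iso_single_of_isStrictly {C : Type*} [Category* C] [Abelian C]
    (K : CochainComplex C ℤ) (n : ℤ) [K.IsStrictlyGE n] [K.IsStrictlyLE n] (T : C)
    (e : K.X n ≅ T) : Nonempty (K ≅ (CochainComplex.singleFunctor C n).obj T) := by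
  obtain ⟨M, ⟨f⟩⟩ := K.exists_iso_single n
  let g : M ≅ T := (HomologicalComplex.singleObjXSelf (ComplexShape.up ℤ) n M).symm ≪≫
    (HomologicalComplex.eval _ _ n).mapIso f.symm ≪≫ e
  exact ⟨f ≪≫ (CochainComplex.singleFunctor C n).mapIso g⟩

variable (k A : Type u) [Field k] [Ring A] [Algebra k A]

/-- The tensor product of a complex concentrated in one degree with itself. -/
theorem nonempty_tensorOp_iso_single (R : CochainComplex (ModuleCat.{u} (Env k A)) ℤ) (n : ℤ)
    [hR : R.IsStrictlyGE n] [hR' : R.IsStrictlyLE n] (N : ModuleCat.{u} (Env k A))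
    (e : R.X n ≅ N) :
    Nonempty (tensorOp k A R ≅ (CochainComplex.singleFunctor _ (n + n)).obj
      ((ModuleCat.restrictScalars
        (swapOp k A : Env k A ⊗[k] Env k A →ₐ[k] Env k A ⊗[k] Env k A).toRingHom).obj
        (extTensorObj k N N))) := by
  let H := HomologicalComplex.mapBifunctor R R
      (extTensor k (Env k A) (Env k A)) (ComplexShape.up ℤ)
  have hz : ∀ i j, ¬ (i = n ∧ j = n) → IsZero
      (((extTensor k (Env k A) (Env k A)).obj (R.X i)).obj (R.X j)) := by
    intro i j hij
    by_cases hi : i = n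
    · have hj : j ≠ n := fun hj => hij ⟨hi, hj⟩
      refine ((extTensor k (Env k A) (Env k A)).obj (R.X i)).map_isZero ?_
      rcases lt_or_gt_of_ne hj with hj | hj
      · exact CochainComplex.isZero_of_isStrictlyGE R n j hj
      · exact CochainComplex.isZero_of_isStrictlyLE R n j hj
    · have : IsZero (R.X i) := by
        rcases lt_or_gt_of_ne hi with hi | hi
        · exact CochainComplex.isZero_of_isStrictlyGE R n i hi
        · exact CochainComplex.isZero_of_isStrictlyLE R n i hi
      exact ((extTensor k (Env k A) (Env k A)).map_isZero this).obj _
  have hH : ∀ i, i ≠ n + n → IsZero (H.X i) := by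
    intro i hi
    rw [IsZero.iff_id_eq_zero]
    apply HomologicalComplex.mapBifunctor.hom_ext
    intro i₁ i₂ h
    have h' : i₁ + i₂ = i := h
    exact (hz i₁ i₂ (by omega)).eq_of_src _ _
  -- The only nonzero summand of the tensor square is the one at (n, n). Its inclusion is an
  -- epimorphism, since maps out of the total object are determined on summands, and it is split by
  -- `p`.
  let ι := HomologicalComplex.ιMapBifunctor R R (extTensor k (Env k A) (Env k A))
    (ComplexShape.up ℤ) n n (n + n) rfl
  have : Epi ι := ⟨fun f g hfg => by
    apply HomologicalComplex.mapBifunctor.hom_ext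
    intro i₁ i₂ h
    by_cases hi : i₁ = n ∧ i₂ = n
    · obtain ⟨rfl, rfl⟩ := hi
      exact hfg
    · exact (hz _ _ hi).eq_of_src _ _⟩
  let p : H.X (n + n) ⟶ ((extTensor k (Env k A) (Env k A)).obj (R.X n)).obj (R.X n) :=
    HomologicalComplex.mapBifunctorDesc fun i₁ i₂ _ =>
      if h : n = i₁ ∧ n = i₂ then eqToHom (by rw [← h.1, ← h.2]) else 0
  have hp : ι ≫ p = 𝟙 _ := by
    refine (HomologicalComplex.ι_mapBifunctorDesc _ n n rfl).trans ?_
    rw [dif_pos ⟨rfl, rfl⟩]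
    rfl
  have : IsSplitMono ι := ⟨⟨⟨p, hp⟩⟩⟩
  have : IsIso ι := isIso_of_epi_of_isSplitMono ι
  have hGE : CochainComplex.IsStrictlyGE H (n + n) :=
    (CochainComplex.isStrictlyGE_iff _ _).2 fun i hi => hH i hi.ne
  have hLE : CochainComplex.IsStrictlyLE H (n + n) :=
    (CochainComplex.isStrictlyLE_iff _ _).2 fun i hi => hH i hi.ne'
  let F : ModuleCat.{u} (Env k A ⊗[k] Env k A) ⥤ ModuleCat.{u} (Env k A ⊗[k] Env k A) :=
    ModuleCat.restrictScalars (swapOp k A : _ →ₐ[k] _).toRingHom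
  have : (tensorOp k A R).IsStrictlyGE (n + n) := by
    dsimp only [tensorOp]; infer_instance
  have : (tensorOp k A R).IsStrictlyLE (n + n) := by
    dsimp only [tensorOp]; infer_instance
  exact nonempty_iso_single_of_isStrictly _ _ _ (F.mapIso ((asIso ι).symm ≪≫
    ((extTensor k (Env k A) (Env k A)).mapIso e).app _ ≪≫
      ((extTensor k (Env k A) (Env k A)).obj N).mapIso e))

end Concentrated

/-! ## Rigidity -/

section RigidTensor

open Abelian

variable {k A : Type u} [Field k] [Ring A] [Algebra k A]

/-- The elements of an external tensor product. -/
def toExtTensor {E F : Type u} [Ring E] [Algebra k E] [Ring F] [Algebra k F]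
    (M : ModuleCat.{u} E) (N : ModuleCat.{u} F) : M ⊗[k] N ≃+ extTensorObj k M N :=
  AddEquiv.refl _

theorem smul_toExtTensor {E F : Type u} [Ring E] [Algebra k E] [Ring F] [Algebra k F]
    (M : ModuleCat.{u} E) (N : ModuleCat.{u} F) (x : E) (y : F) (m : M) (n : N) :
    (x ⊗ₜ[k] y) • toExtTensor M N (m ⊗ₜ n) = toExtTensor M N ((x • m) ⊗ₜ[k] (y • n)) := rfl

variable (ν : A ≃ₐ[k] A)

/-- The twisted bimodule `^ν A ^1`. -/
abbrev twistRegular : ModuleCat.{u} (Env k A) := twist ν AlgEquiv.refl (regularBimodule k A)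

/-- The elements of the twisted bimodule `^ν A ^1`. -/
def toTwistRegular : A ≃+ twistRegular ν :=
  (toRegular k A).trans (toTwist ν AlgEquiv.refl _)

theorem smul_toTwistRegular (a b x : A) :
    (a ⊗ₜ[k] op b : Env k A) • toTwistRegular ν x = toTwistRegular ν (ν a * x * b) := by
  change (a ⊗ₜ[k] op b : Env k A) • toTwist ν AlgEquiv.refl _ (toRegular k A x) = _
  rw [smul_toTwist, smul_toRegular]
  rfl

/-- The elements of the twisted bimodule `^ν A ^1`, linearly over the base field. -/
def toTwistRegularₗ : A ≃ₗ[k] twistRegular ν :=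
  { toTwistRegular ν with
    map_smul' := fun r x => by
      have h := smul_toTwistRegular ν (algebraMap k A r) 1 x
      rw [AlgEquiv.commutes, mul_one, ← Algebra.smul_def] at h
      refine h.symm.trans ?_
      change ((algebraMap k A r) ⊗ₜ[k] (1 : Aᵐᵒᵖ)) • toTwistRegular ν x =
        algebraMap k (Env k A) r • toTwistRegular ν x
      rw [Algebra.TensorProduct.algebraMap_apply] }

/-- The `Aᵉ ⊗ Aᵉ`-module `R ⊗ Rᵒᵖ` for `R = ^ν A ^1`. -/
abbrev twistTensor : ModuleCat.{u} (Env k A ⊗[k] Env k A) :=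
  (ModuleCat.restrictScalars
    (swapOp k A : Env k A ⊗[k] Env k A →ₐ[k] Env k A ⊗[k] Env k A).toRingHom).obj
    (extTensorObj k (twistRegular ν) (twistRegular ν))

/-- The elements of `^ν A ^1 ⊗ (^ν A ^1)ᵒᵖ`, as a free module over the enveloping algebra. -/
def toTwistTensor : Env k A ≃+ twistTensor ν :=
  (TensorProduct.congr (ν.toLinearEquiv.trans (toTwistRegularₗ ν))
    ((opLinearEquiv k).symm.trans (toTwistRegularₗ ν))).toAddEquiv.trans (toExtTensor _ _)

theorem toTwistTensor_tmul (x y : A) : toTwistTensor ν (x ⊗ₜ op y) =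
    toExtTensor _ _ (toTwistRegular ν (ν x) ⊗ₜ[k] toTwistRegular ν y) := rfl

/-- Under x ⊗ op y ↦ ν(x) ⊗ y, the outer action becomes left multiplication on Aᵉ. The inner action
multiplies ν(x) by c on the right, which forces ν⁻¹(c) on x, and y by ν(b') on the left. -/
theorem smul_toTwistTensor (a b b' c x y : A) :
    ((a ⊗ₜ[k] op b : Env k A) ⊗ₜ[k] (b' ⊗ₜ[k] op c : Env k A)) •
      toTwistTensor ν (x ⊗ₜ op y) = toTwistTensor ν
        ((a ⊗ₜ op b) * (x ⊗ₜ op y) * (ν.symm c ⊗ₜ op (ν b'))) := by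
  rw [Algebra.TensorProduct.tmul_mul_tmul, Algebra.TensorProduct.tmul_mul_tmul, ← op_mul,
    ← op_mul, toTwistTensor_tmul, toTwistTensor_tmul]
  refine (smul_toExtTensor (twistRegular ν) (twistRegular ν) (a ⊗ₜ[k] op c) (b' ⊗ₜ[k] op b)
    _ _).trans ?_
  rw [smul_toTwistRegular, smul_toTwistRegular, map_mul ν, map_mul ν, ν.apply_symm_apply, mul_assoc (ν b')]

theorem tmul_one_smul_toTwistTensor (a b : A) (z : Env k A) :
    ((a ⊗ₜ[k] op b : Env k A) ⊗ₜ[k] (1 : Env k A)) • toTwistTensor ν z =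
      toTwistTensor ν ((a ⊗ₜ op b) * z) := by
  induction z using TensorProduct.induction_on with
  | zero => rw [mul_zero, map_zero, smul_zero]
  | add z w hz hw => rw [map_add, smul_add, hz, hw, mul_add, map_add]
  | tmul x y =>
    obtain ⟨y, rfl⟩ := op_surjective y
    refine (smul_toTwistTensor ν a b 1 1 x y).trans ?_
    rw [map_one, map_one]
    exact congrArg (toTwistTensor ν) (mul_one _)

theorem one_tmul_smul_toTwistTensor (b c : A) (z : Env k A) :
    ((1 : Env k A) ⊗ₜ[k] (b ⊗ₜ[k] op c : Env k A)) • toTwistTensor ν z =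
      toTwistTensor ν (z * (ν.symm c ⊗ₜ op (ν b))) := by
  induction z using TensorProduct.induction_on with
  | zero => rw [zero_mul, map_zero, smul_zero]
  | add z w hz hw => rw [map_add, smul_add, hz, hw, add_mul, map_add]
  | tmul x y =>
    obtain ⟨y, rfl⟩ := op_surjective y
    refine (smul_toTwistTensor ν 1 1 b c x y).trans ?_
    exact congrArg (fun t => toTwistTensor ν (t * _)) (one_mul _)

/-- The outer bimodule structure of `^ν A ^1 ⊗ (^ν A ^1)ᵒᵖ` is free of rank one. -/
def twistTensorIso : ModuleCat.of (Env k A) (Env k A) ≅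
    (resFst k (Env k A) (Env k A)).obj (twistTensor ν) :=
  isoOfSmul (M := ModuleCat.of (Env k A) (Env k A))
    (N := (resFst k (Env k A) (Env k A)).obj (twistTensor ν)) (toTwistTensor ν)
    (map_smul_of_tmul (M := ModuleCat.of (Env k A) (Env k A))
      (N := (resFst k (Env k A) (Env k A)).obj (twistTensor ν)) (toTwistTensor ν).toAddMonoidHom fun a b z => by
      obtain ⟨b, rfl⟩ := op_surjective b
      exact (tmul_one_smul_toTwistTensor ν a b z).symm)

theorem twistTensorIso_hom_actRight (b c : A) :
    (twistTensorIso ν).hom ≫ (actRight (b ⊗ₜ[k] op c : Env k A)).app (twistTensor ν) =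
      rightMul (ν.symm c ⊗ₜ[k] op (ν b)) ≫ (twistTensorIso ν).hom := by
  apply ModuleCat.hom_ext
  apply LinearMap.ext
  intro z
  exact one_tmul_smul_toTwistTensor ν b c z

theorem actRight_add {B C : Type u} [Ring B] [Algebra k B] [Ring C] [Algebra k C]
    (c c' : C) (M : ModuleCat.{u} (B ⊗[k] C)) :
    (actRight (c + c')).app M = (actRight c).app M + (actRight c').app M := by
  have key : ∀ m : M, ((1 : B) ⊗ₜ[k] (c + c')) • m =
      ((1 : B) ⊗ₜ[k] c) • m + ((1 : B) ⊗ₜ[k] c') • m := fun m => by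
    rw [TensorProduct.tmul_add, add_smul]
  ext m
  exact key m

theorem actRight_zero {B C : Type u} [Ring B] [Algebra k B] [Ring C] [Algebra k C]
    (M : ModuleCat.{u} (B ⊗[k] C)) : (actRight (0 : C)).app M = 0 := by
  have key : ∀ m : M, ((1 : B) ⊗ₜ[k] (0 : C)) • m = 0 := fun m => by
    rw [TensorProduct.tmul_zero]
    exact zero_smul (B ⊗[k] C) m
  ext m
  exact key m

end RigidTensor

/-! ### Rigidity of the shifted Nakayama twist -/

section RigidHopf

open Abelian

attribute [local instance] HasDerivedCategory.standard

variable {k A : Type u} [Field k] [Ring A] [HopfAlgebra k A]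

/-- Rigidity of a shift of `^ν A ^1`, where `ν` is the Nakayama automorphism. -/
theorem nonempty_rigid_iso {d : ℕ} [IsNoetherianRing A]
    (hS : Function.Bijective (HopfAlgebra.antipode k (A := A)))
    (h : IsASGorenstein k A (Bialgebra.counitAlgHom k A) d)
    (R : CochainComplex (ModuleCat.{u} (Env k A)) ℤ)
    (g : R ≅ (CochainComplex.singleFunctor _ (-d : ℤ)).obj (twistRegular (nakayamaAut hS h)))
    (hR : CochainComplex.plus _ (tensorOp k A R)) :
    Nonempty (DerivedCategory.Q.obj R ≅
      rHom k (Env k A) (regularBimodule k A) ⟨tensorOp k A R, hR⟩) := by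
  obtain ⟨Θ, hΘ⟩ := exists_hochschild_equiv hS h
  let ν := nakayamaAut hS h
  let ψ := twistTensorIso ν
  let Ψ : ∀ i, Ext.{u} (regularBimodule k A) (ModuleCat.of (Env k A) (Env k A)) i ≃+
      Ext.{u} (regularBimodule k A)
        ((resFst k (Env k A) (Env k A)).obj (twistTensor ν)) i := fun i =>
    { toFun := fun x => x.comp (Ext.mk₀ ψ.hom) (add_zero i)
      invFun := fun x => x.comp (Ext.mk₀ ψ.inv) (add_zero i)
      left_inv := fun x => by
        dsimp only
        rw [Ext.comp_assoc_of_third_deg_zero, Ext.mk₀_comp_mk₀, Iso.hom_inv_id, Ext.comp_mk₀_id]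
      right_inv := fun x => by
        dsimp only
        rw [Ext.comp_assoc_of_third_deg_zero, Ext.mk₀_comp_mk₀, Iso.inv_hom_id, Ext.comp_mk₀_id]
      map_add' := fun x y => Ext.add_comp _ _ _ _ }
  have hΨ : ∀ i x, Ψ i x = x.comp (Ext.mk₀ ψ.hom) (add_zero i) := fun _ _ => rfl
  let θ := ((toTwistRegular ν).symm.trans Θ).trans (Ψ d)
  have hθ : ∀ (c : Env k A) (x : twistRegular ν),
      θ (c • x) = (θ x).comp (Ext.mk₀ ((actRight c).app (twistTensor ν))) (add_zero d) := by
    intro c x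
    induction c using TensorProduct.induction_on with
    | zero =>
      rw [actRight_zero, Ext.mk₀_zero, Ext.comp_zero]
      exact (congrArg θ (zero_smul (Env k A) x)).trans (map_zero θ)
    | add c c' hc hc' => rw [add_smul, map_add, hc, hc', actRight_add, Ext.mk₀_add, Ext.comp_add]
    | tmul b c =>
      obtain ⟨c, rfl⟩ := op_surjective c
      obtain ⟨x, rfl⟩ := (toTwistRegular ν).surjective x
      rw [smul_toTwistRegular]
      change Ψ d (Θ (ν b * x * c)) = (Ψ d (Θ x)).comp _ _
      rw [hΨ, hΨ, Ext.comp_assoc_of_third_deg_zero, Ext.mk₀_comp_mk₀,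
        twistTensorIso_hom_actRight, ← Ext.mk₀_comp_mk₀, ← Ext.comp_assoc_of_third_deg_zero, hΘ]
      -- By `hΘ`, right multiplication by ν⁻¹(c) ⊗ op ν(b) gives ν(b) x ν(ν⁻¹(c)) = ν(b) x c, the
      -- action on ^νA^1.
      congr 3
      exact (ν.apply_symm_apply c).symm
  have := CochainComplex.isStrictlyGE_of_iso g.symm (-d)
  have := CochainComplex.isStrictlyLE_of_iso g.symm (-d)
  obtain ⟨t⟩ := nonempty_tensorOp_iso_single k A R (-d) (twistRegular ν)
    ((HomologicalComplex.eval _ _ (-d : ℤ)).mapIso g ≪≫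
      HomologicalComplex.singleObjXSelf (ComplexShape.up ℤ) (-d : ℤ) _)
  -- The target module sits in degree -2d and its only `Ext` is in degree d, so the result sits in
  -- degree -d, as does R.
  obtain ⟨r⟩ := nonempty_rHom_iso_single (regularBimodule k A) ⟨tensorOp k A R, hR⟩
    (twistTensor ν) (-d + -d) t d (twistRegular ν)
    (fun i hi => by
      have := subsingleton_hochschild h i hi
      exact (Ψ i).symm.injective.subsingleton) θ hθ (-d) (by omega)
  exact ⟨DerivedCategory.Q.mapIso g ≪≫ r.symm⟩

end RigidHopf

/-! ## Complexes of finite injective dimension -/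

section FiniteInjDim

open Limits

attribute [local instance] HasDerivedCategory.standard

section

universe v u₁

variable {C : Type u₁} [Category.{v} C] [Abelian C]

theorem Q_map_surjective_of_isKInjective (K L : CochainComplex C ℤ) [L.IsKInjective]
    (φ : DerivedCategory.Q.obj K ⟶ DerivedCategory.Q.obj L) :
    ∃ f : K ⟶ L, DerivedCategory.Q.map f = φ := by
  obtain ⟨g, hg⟩ := (CochainComplex.IsKInjective.Qh_map_bijective
    ((HomotopyCategory.quotient C _).obj K) L).surjective φ
  obtain ⟨f, rfl⟩ := (HomotopyCategory.quotient C _).map_surjective g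
  exact ⟨f, hg⟩

theorem Q_map_surjective_of_isKProjective (K L : CochainComplex C ℤ) [K.IsKProjective]
    (φ : DerivedCategory.Q.obj K ⟶ DerivedCategory.Q.obj L) :
    ∃ f : K ⟶ L, DerivedCategory.Q.map f = φ := by
  obtain ⟨g, hg⟩ := (CochainComplex.IsKProjective.Qh_map_bijective
    K ((HomotopyCategory.quotient C _).obj L)).surjective φ
  obtain ⟨f, rfl⟩ := (HomotopyCategory.quotient C _).map_surjective g
  exact ⟨f, hg⟩

theorem homotopic_of_Q_map_eq (K L : CochainComplex C ℤ) [K.IsKProjective] (f g : K ⟶ L)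
    (h : DerivedCategory.Q.map f = DerivedCategory.Q.map g) : Nonempty (Homotopy f g) :=
  ⟨HomotopyCategory.homotopyOfEq _ _ ((CochainComplex.IsKProjective.Qh_map_bijective
    K ((HomotopyCategory.quotient C _).obj L)).injective h)⟩

end

variable {B : Type u} [Ring B]

theorem HasFiniteInjDim.of_iso {X Y : CochainComplex (ModuleCat.{u} B) ℤ}
    (hX : HasFiniteInjDim X) (e : DerivedCategory.Q.obj X ≅ DerivedCategory.Q.obj Y) :
    HasFiniteInjDim Y := by
  obtain ⟨I, hI, hI', ⟨f⟩⟩ := hX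
  exact ⟨I, hI, hI', ⟨e.symm ≪≫ f⟩⟩

theorem HasFiniteInjDim.shift {X : CochainComplex (ModuleCat.{u} B) ℤ} (hX : HasFiniteInjDim X)
    (n : ℤ) : HasFiniteInjDim ((shiftFunctor (CochainComplex (ModuleCat.{u} B) ℤ) n).obj X) := by
  obtain ⟨I, ⟨a, b, ha, hb⟩, hI, ⟨f⟩⟩ := hX
  refine ⟨(shiftFunctor (CochainComplex (ModuleCat.{u} B) ℤ) n).obj I, ⟨a - n, b - n,
    I.isStrictlyGE_shift a n _ (by omega), I.isStrictlyLE_shift b n _ (by omega)⟩,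
    fun i => hI (i + n), ⟨?_⟩⟩
  exact (DerivedCategory.Q.commShiftIso n).app X ≪≫
    (shiftFunctor (DerivedCategory (ModuleCat.{u} B)) n).mapIso f ≪≫
    ((DerivedCategory.Q.commShiftIso n).app I).symm

theorem injective_single_X {J : ModuleCat.{u} B} (hJ : Injective J) (n i : ℤ) :
    Injective (((CochainComplex.singleFunctor (ModuleCat.{u} B) n).obj J).X i) := by
  by_cases h : i = n
  · subst h
    exact Injective.of_iso (HomologicalComplex.singleObjXSelf (ComplexShape.up ℤ) i J).symm hJ
  · exact (HomologicalComplex.isZero_single_obj_X (ComplexShape.up ℤ) n J i h).injective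

/-- Induction on the dimension: embed L in an injective J and replace the cokernel by a bounded
injective complex I. Since J is injective, L[1] is the cone of a chain map from J to I, itself a
bounded complex of injectives. -/
theorem hasFiniteInjDim_single (n : ℕ) (L : ModuleCat.{u} B)
    (hL : HasInjectiveDimensionLT L (n + 1)) :
    HasFiniteInjDim ((CochainComplex.singleFunctor (ModuleCat.{u} B) 0).obj L) := by
  induction n generalizing L with
  | zero =>
    have : Injective L := injective_iff_hasInjectiveDimensionLT_one.2 hL
    exact ⟨_, ⟨0, 0, inferInstance, inferInstance⟩, injective_single_X this 0, ⟨Iso.refl _⟩⟩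
  | succ n ih =>
    let P : InjectivePresentation L := Classical.arbitrary _
    let S := ShortComplex.mk _ _ (cokernel.condition P.f)
    have hS : S.ShortExact := { exact := ShortComplex.exact_cokernel P.f }
    have hJ : Injective S.X₂ := P.injective
    obtain ⟨I, ⟨a, b, ha, hb⟩, hI, ⟨e⟩⟩ := ih S.X₃ ((hS.hasInjectiveDimensionLT_X₃_iff n hJ).2 hL)
    have : I.IsKInjective := CochainComplex.isKInjective_of_injective I a
    let J := (CochainComplex.singleFunctor (ModuleCat.{u} B) 0).obj S.X₂
    -- I is K-injective, so the derived morphism from J is realised by an actual chain map and its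
    -- cone can be formed.
    obtain ⟨f, hf⟩ := Q_map_surjective_of_isKInjective J I
      (DerivedCategory.Q.map ((CochainComplex.singleFunctor (ModuleCat.{u} B) 0).map S.g) ≫ e.hom)
    let t := Pretriangulated.isoTriangleOfIso₁₂ hS.singleTriangle.rotate
      (DerivedCategory.Q.mapTriangle.obj (CochainComplex.mappingCone.triangle f))
      (Pretriangulated.rot_of_distTriang _ hS.singleTriangle_distinguished)
      (DerivedCategory.mappingCone_triangle_distinguished f)
      (Iso.refl _) e (by
        refine Eq.trans ?_ (Category.id_comp _).symm
        exact hf.symm)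
    have : HasFiniteInjDim (CochainComplex.mappingCone f) := by
      have hJa : J.IsStrictlyGE 0 := inferInstance
      have hJb : J.IsStrictlyLE 0 := inferInstance
      -- The cone in degree i is the sum of J in degree i + 1 and I in degree i, so J contributes
      -- only in degree -1.
      refine ⟨CochainComplex.mappingCone f, ⟨min a (-1), max b 0, ?_, ?_⟩, fun i => ?_,
        ⟨Iso.refl _⟩⟩
      · refine (CochainComplex.isStrictlyGE_iff _ _).2 fun i hi => ?_
        exact (CochainComplex.mappingCone.isZero_X_iff f i).2
          ⟨J.isZero_of_isStrictlyGE 0 _ (by omega), I.isZero_of_isStrictlyGE a _ (by omega)⟩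
      · refine (CochainComplex.isStrictlyLE_iff _ _).2 fun i hi => ?_
        exact (CochainComplex.mappingCone.isZero_X_iff f i).2
          ⟨J.isZero_of_isStrictlyLE 0 _ (by omega), I.isZero_of_isStrictlyLE b _ (by omega)⟩
      · have := injective_single_X hJ 0 (i + 1)
        have := hI i
        exact Injective.of_iso (HomologicalComplex.homotopyCofiber.XIsoBiprod f i (i + 1) rfl).symm
          inferInstance
    exact (this.shift (-1)).of_iso ((DerivedCategory.Q.commShiftIso (-1)).app _ ≪≫
      (shiftFunctor (DerivedCategory (ModuleCat.{u} B)) (-1)).mapIso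
        (Pretriangulated.Triangle.π₃.mapIso t).symm ≪≫
      (shiftFunctorCompIsoId (DerivedCategory (ModuleCat.{u} B)) 1 (-1) (by omega)).app _)

end FiniteInjDim

/-! ## Dualising complexes concentrated in one degree -/

section ConcentratedComplex

open Limits

attribute [local instance] HasDerivedCategory.standard

section

universe v u₁

variable {C : Type u₁} [Category.{v} C] [Abelian C] (K : CochainComplex C ℤ) (m : ℤ)

theorem isZero_X_of_concentrated [K.IsStrictlyGE m] [K.IsStrictlyLE m] (i : ℤ) (hi : i ≠ m) :
    IsZero (K.X i) := by
  rcases lt_or_gt_of_ne hi with hi | hi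
  · exact K.isZero_of_isStrictlyGE m i hi
  · exact K.isZero_of_isStrictlyLE m i hi

theorem isKProjective_of_concentrated [K.IsStrictlyGE m] [K.IsStrictlyLE m]
    (hK : Projective (K.X m)) : K.IsKProjective := by
  have : ∀ i, Projective (K.X i) := fun i => by
    by_cases hi : i = m
    · rwa [hi]
    · exact (isZero_X_of_concentrated K m i hi).projective
  exact CochainComplex.isKProjective_of_projective K m

/-- Projectivity makes K K-projective, so derived morphisms are realised by chain maps; for n ≠ 0
the two complexes have no common nonzero degree. -/
theorem subsingleton_hom_shift [K.IsStrictlyGE m] [K.IsStrictlyLE m] (hK : Projective (K.X m))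
    (n : ℤ) (hn : n ≠ 0) : Subsingleton
      (DerivedCategory.Q.obj K ⟶ (shiftFunctor (DerivedCategory C) n).obj
        (DerivedCategory.Q.obj K)) := by
  have := isKProjective_of_concentrated K m hK
  let e := (DerivedCategory.Q.commShiftIso n).app K
  have h : ∀ f : K ⟶ (shiftFunctor (CochainComplex C ℤ) n).obj K, f = 0 := fun f => by
    ext i
    by_cases hi : i = m
    · exact (isZero_X_of_concentrated K m (i + n) (by omega)).eq_of_tgt _ _
    · exact (isZero_X_of_concentrated K m i hi).eq_of_src _ _
  have h' : ∀ φ : DerivedCategory.Q.obj K ⟶ (shiftFunctor (DerivedCategory C) n).obj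
      (DerivedCategory.Q.obj K), φ = 0 := fun φ => by
    obtain ⟨f, hf⟩ := Q_map_surjective_of_isKProjective K _ (φ ≫ e.inv)
    rw [h f, Functor.map_zero] at hf
    exact ((cancel_mono e.inv).1 (hf.symm.trans zero_comp.symm))
  exact ⟨fun φ ψ => (h' φ).trans (h' ψ).symm⟩

/-- K-projectivity identifies derived endomorphisms with homotopy classes of chain maps, and every
homotopy vanishes because it changes the degree. -/
theorem Q_map_bijective_of_concentrated [K.IsStrictlyGE m] [K.IsStrictlyLE m]
    (hK : Projective (K.X m)) :
    Function.Bijective fun f : K ⟶ K => DerivedCategory.Q.map f := by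
  have := isKProjective_of_concentrated K m hK
  refine ⟨fun f g h => ?_, Q_map_surjective_of_isKProjective K K⟩
  obtain ⟨s⟩ := homotopic_of_Q_map_eq K K f g h
  have hs : ∀ i j, s.hom i j = 0 := fun i j => by
    by_cases hi : i = m
    · by_cases hj : j = m
      · exact s.zero i j (by subst hi hj; simp)
      · exact (isZero_X_of_concentrated K m j hj).eq_of_tgt _ _
    · exact (isZero_X_of_concentrated K m i hi).eq_of_src _ _
  ext i
  have := s.comm i
  rwa [dNext_eq _ (show (ComplexShape.up ℤ).Rel i (i + 1) from rfl),
    prevD_eq _ (show (ComplexShape.up ℤ).Rel (i - 1) i by simp), hs, hs, comp_zero, zero_comp,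
    zero_add, zero_add] at this

theorem eval_bijective_of_concentrated [K.IsStrictlyGE m] [K.IsStrictlyLE m] :
    Function.Bijective fun f : K ⟶ K => f.f m := by
  constructor
  · intro f g h
    ext i
    by_cases hi : i = m
    · subst hi
      exact h
    · exact (isZero_X_of_concentrated K m i hi).eq_of_src _ _
  · intro φ
    refine ⟨{ f := fun i => if h : i = m then eqToHom (by rw [h]) ≫ φ ≫ eqToHom (by rw [h]) else 0
              comm' := fun i j hij => ?_ }, ?_⟩
    · by_cases hi : i = m
      · have hij' : i + 1 = j := hij
        exact (isZero_X_of_concentrated K m j (by omega)).eq_of_tgt _ _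
      · exact (isZero_X_of_concentrated K m i hi).eq_of_src _ _
    · simp

end

variable {B : Type u} [Ring B]

theorem homologicallyFinite_of_concentrated (K : CochainComplex (ModuleCat.{u} B) ℤ) (m : ℤ)
    (L : ModuleCat.{u} B) (e : K ≅ (CochainComplex.singleFunctor _ m).obj L)
    (hL : Module.Finite B L) : HomologicallyFinite K := by
  have := CochainComplex.isStrictlyGE_of_iso e.symm m
  have := CochainComplex.isStrictlyLE_of_iso e.symm m
  let f : K.homology m ≅ L := (HomologicalComplex.homologyFunctor _ _ m).mapIso e ≪≫
    HomologicalComplex.singleObjHomologySelfIso (ComplexShape.up ℤ) m L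
  have : Module.Finite B (K.homology m) := Module.Finite.equiv f.toLinearEquiv.symm
  have h0 : ∀ i, i ≠ m → Subsingleton (K.homology i) := fun i hi =>
    ModuleCat.subsingleton_of_isZero
      (ShortComplex.isZero_homology_of_isZero_X₂ _ (isZero_X_of_concentrated K m i hi))
  refine Module.Finite.of_surjective
    (DirectSum.lof B ℤ (fun i => K.homology i) m) fun x => ⟨x m, ?_⟩
  refine DFinsupp.ext fun i => ?_
  by_cases hi : i = m
  · subst hi
    exact DirectSum.lof_apply B i _
  · have := h0 i hi
    exact Subsingleton.elim _ _

end ConcentratedComplex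

/-! ### One-sided endomorphisms of the Nakayama twist -/

section Dualising

open Limits

attribute [local instance] HasDerivedCategory.standard

variable {k A : Type u} [Field k] [Ring A] [Algebra k A] (ν : A ≃ₐ[k] A)

/-- The left module underlying `^ν A ^1` is free of rank one. -/
def twistRegularLeftIso : ModuleCat.of A A ≅ (resLeft k A).obj (twistRegular ν) :=
  isoOfSmul (M := ModuleCat.of A A) (N := (resLeft k A).obj (twistRegular ν))
    (ν.toRingEquiv.toAddEquiv.trans (toTwistRegular ν)) fun a x => by
      refine Eq.trans ?_ (smul_toTwistRegular ν a 1 (ν x)).symm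
      rw [mul_one, ← map_mul ν]
      rfl

/-- The right module underlying `^ν A ^1` is free of rank one. -/
def twistRegularRightIso : ModuleCat.of Aᵐᵒᵖ Aᵐᵒᵖ ≅ (resRight k A).obj (twistRegular ν) :=
  isoOfSmul (M := ModuleCat.of Aᵐᵒᵖ Aᵐᵒᵖ) (N := (resRight k A).obj (twistRegular ν))
    (opAddEquiv.symm.trans (toTwistRegular ν)) fun a x => by
      obtain ⟨a, rfl⟩ := op_surjective a
      obtain ⟨x, rfl⟩ := op_surjective x
      refine Eq.trans ?_ (smul_toTwistRegular ν 1 a x).symm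
      rw [map_one, one_mul]
      rfl

/-- As ν is onto, 1 generates the left module ^νA, so a left-linear endomorphism is right
multiplication by the image of 1. -/
theorem actRight_twistRegular_bijective : Function.Bijective fun a : A =>
    (actRight (k := k) (B := A) (op a)).app (twistRegular ν) := by
  have key : ∀ a x, ((actRight (k := k) (B := A) (op a)).app (twistRegular ν)).hom
      (toTwistRegular ν x) = toTwistRegular ν (x * a) := fun a x => by
    refine (smul_toTwistRegular ν 1 a x).trans ?_
    rw [map_one, one_mul]
  constructor
  · intro a b h
    have h1 := (key a 1).symm.trans ((congr($(h).hom (toTwistRegular ν 1))).trans (key b 1))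
    simpa using (toTwistRegular ν).injective h1
  · intro φ
    obtain ⟨a, ha⟩ := (toTwistRegular ν).surjective (φ.hom (toTwistRegular ν 1))
    refine ⟨a, ?_⟩
    ext x
    obtain ⟨x, rfl⟩ := (toTwistRegular ν).surjective x
    refine (key a x).trans ?_
    have h1 : ∀ y, envL k (ν.symm x) • toTwistRegular ν y = toTwistRegular ν (x * y) := fun y => by
      refine (smul_toTwistRegular ν (ν.symm x) 1 y).trans ?_
      rw [mul_one, ν.apply_symm_apply]
    have h2 : φ.hom (toTwistRegular ν (x * 1)) = envL k (ν.symm x) • φ.hom (toTwistRegular ν 1) :=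
      (congrArg φ.hom (h1 1).symm).trans (φ.hom.map_smul (ν.symm x) (toTwistRegular ν 1))
    rw [mul_one] at h2
    refine Eq.trans ?_ h2.symm
    rw [← h1]
    exact congrArg (envL k (ν.symm x) • ·) ha

/-- Right-linear endomorphisms are left multiplications by the image of 1; the left action passes
through ν, hence the witness ν⁻¹ of that image. -/
theorem actLeft_twistRegular_bijective : Function.Bijective fun a : A =>
    (actLeft (k := k) (C := Aᵐᵒᵖ) a).app (twistRegular ν) := by
  have key : ∀ a x, ((actLeft (k := k) (C := Aᵐᵒᵖ) a).app (twistRegular ν)).hom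
      (toTwistRegular ν x) = toTwistRegular ν (ν a * x) := fun a x => by
    refine (smul_toTwistRegular ν a 1 x).trans ?_
    rw [mul_one]
  constructor
  · intro a b h
    have h1 := (key a 1).symm.trans ((congr($(h).hom (toTwistRegular ν 1))).trans (key b 1))
    simpa using (toTwistRegular ν).injective h1
  · intro φ
    obtain ⟨a, ha⟩ := (toTwistRegular ν).surjective (φ.hom (toTwistRegular ν 1))
    refine ⟨ν.symm a, ?_⟩
    ext x
    obtain ⟨x, rfl⟩ := (toTwistRegular ν).surjective x
    refine (key _ x).trans ?_
    have h1 : ∀ y, envR k x • toTwistRegular ν y = toTwistRegular ν (y * x) := fun y => by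
      refine (smul_toTwistRegular ν 1 x y).trans ?_
      rw [map_one, one_mul]
    have h2 : φ.hom (toTwistRegular ν (1 * x)) = envR k x • φ.hom (toTwistRegular ν 1) :=
      (congrArg φ.hom (h1 1).symm).trans (φ.hom.map_smul (op x) (toTwistRegular ν 1))
    rw [one_mul] at h2
    refine Eq.trans ?_ h2.symm
    rw [ν.apply_symm_apply, ← h1]
    exact congrArg (envR k x • ·) ha

/-- Conjugating natural endomorphisms by an isomorphism. -/
theorem app_bijective_of_iso {ι C D : Type*} [Category* C] [Category* D] {F : C ⥤ D}
    (α : ι → (F ⟶ F)) {M N : C} (e : M ≅ N)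
    (h : Function.Bijective fun i => (α i).app N) : Function.Bijective fun i => (α i).app M := by
  have : (fun i => (α i).app M) =
      (fun f : F.obj N ⟶ F.obj N => F.map e.hom ≫ f ≫ F.map e.inv) ∘ fun i => (α i).app N := by
    funext i
    simp
  rw [this]
  refine Function.Bijective.comp ⟨fun f g hfg => ?_, fun g => ⟨F.map e.inv ≫ g ≫ F.map e.hom, ?_⟩⟩ h
  · exact (cancel_mono (F.map e.inv)).1 ((cancel_epi (F.map e.hom)).1 hfg)
  · simp [← Functor.map_comp_assoc, ← Functor.map_comp]

end Dualising

/-! ### The dualising property -/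

section RigidDualising

open Limits

attribute [local instance] HasDerivedCategory.standard

/-- A complex isomorphic to a module of finite injective dimension, placed in one degree, has
finite injective dimension. -/
theorem hasFiniteInjDim_of_concentrated {B : Type u} [Ring B] (d : ℕ)
    (K : CochainComplex (ModuleCat.{u} B) ℤ) (L : ModuleCat.{u} B)
    (e : K ≅ (CochainComplex.singleFunctor _ (-d : ℤ)).obj L)
    (hL : injectiveDimension L = d) : HasFiniteInjDim K := by
  have hL' : HasInjectiveDimensionLT L (d + 1) :=
    (injectiveDimension_le_iff L d).1 hL.le
  have e' := ((CochainComplex.singleFunctors (ModuleCat.{u} B)).shiftIso (d : ℤ) (-d) 0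
    (by omega)).app L
  exact ((hasFiniteInjDim_single d L hL').shift (d : ℤ)).of_iso
    (DerivedCategory.Q.mapIso (e' ≪≫ e.symm))

theorem mapHomologicalComplex_iso_single {E B : Type u} [Ring E] [Ring B]
    (F : ModuleCat.{u} E ⥤ ModuleCat.{u} B) [F.Additive] (m : ℤ)
    {R : CochainComplex (ModuleCat.{u} E) ℤ} {N : ModuleCat.{u} E} {L : ModuleCat.{u} B}
    (g : R ≅ (CochainComplex.singleFunctor _ m).obj N) (e : F.obj N ≅ L) :
    Nonempty ((F.mapHomologicalComplex (ComplexShape.up ℤ)).obj R ≅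
      (CochainComplex.singleFunctor _ m).obj L) :=
  ⟨(F.mapHomologicalComplex (ComplexShape.up ℤ)).mapIso g ≪≫
    (HomologicalComplex.singleMapHomologicalComplex F (ComplexShape.up ℤ) m).app N ≪≫
    (CochainComplex.singleFunctor _ m).mapIso e⟩

theorem projective_X_of_iso_single {B : Type u} [Ring B] (m : ℤ)
    (K : CochainComplex (ModuleCat.{u} B) ℤ)
    (e : K ≅ (CochainComplex.singleFunctor _ m).obj (ModuleCat.of B B)) :
    Projective (K.X m) := by
  have : Projective (ModuleCat.of B B) := (IsProjective.iff_projective (R := B) B).1 inferInstance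
  exact Projective.of_iso ((HomologicalComplex.eval _ _ m).mapIso e ≪≫
    HomologicalComplex.singleObjXSelf (ComplexShape.up ℤ) m _).symm this

variable {k A : Type u} [Field k] [Ring A] [Algebra k A]

/-- On each side ^νA^1 is free of rank one. Projectivity reduces the derived endomorphism conditions
to ordinary endomorphisms, and the injective dimension of A supplies the bounded injective
representatives. Any automorphism ν works; only rigidity singles out the Nakayama automorphism. -/
theorem isDualisingComplex_of_iso_single (ν : A ≃ₐ[k] A) (d : ℕ) (hA : HasInjDim A d)
    (R : CochainComplex (ModuleCat.{u} (Env k A)) ℤ)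
    (g : R ≅ (CochainComplex.singleFunctor _ (-d : ℤ)).obj (twistRegular ν)) :
    IsDualisingComplex k A R := by
  obtain ⟨el⟩ := mapHomologicalComplex_iso_single (resLeft k A) (-d) g
    (twistRegularLeftIso ν).symm
  obtain ⟨er⟩ := mapHomologicalComplex_iso_single (resRight k A) (-d) g
    (twistRegularRightIso ν).symm
  have hge : R.IsStrictlyGE (-d) := CochainComplex.isStrictlyGE_of_iso g.symm (-d)
  have hle : R.IsStrictlyLE (-d) := CochainComplex.isStrictlyLE_of_iso g.symm (-d)
  have : (cpxLeft k A R).IsStrictlyGE (-d) := CochainComplex.isStrictlyGE_of_iso el.symm (-d)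
  have : (cpxLeft k A R).IsStrictlyLE (-d) := CochainComplex.isStrictlyLE_of_iso el.symm (-d)
  have : (cpxRight k A R).IsStrictlyGE (-d) := CochainComplex.isStrictlyGE_of_iso er.symm (-d)
  have : (cpxRight k A R).IsStrictlyLE (-d) := CochainComplex.isStrictlyLE_of_iso er.symm (-d)
  have hl := projective_X_of_iso_single _ _ el
  have hr := projective_X_of_iso_single _ _ er
  let f : R.X (-d) ≅ twistRegular ν := (HomologicalComplex.eval _ _ (-d : ℤ)).mapIso g ≪≫
    HomologicalComplex.singleObjXSelf (ComplexShape.up ℤ) (-d : ℤ) _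
  exact
    { bounded := ⟨-d, -d, hge, hle⟩
      injDim_left := hasFiniteInjDim_of_concentrated d _ _ el hA.1
      injDim_right := hasFiniteInjDim_of_concentrated d _ _ er hA.2
      finite_left := homologicallyFinite_of_concentrated _ _ _ el (Module.Finite.self A)
      finite_right := homologicallyFinite_of_concentrated _ _ _ er (Module.Finite.self Aᵐᵒᵖ)
      hom_shift_left := subsingleton_hom_shift _ (-d) hl
      hom_shift_right := subsingleton_hom_shift _ (-d) hr
      end_left := (Q_map_bijective_of_concentrated _ (-d) hl).comp
        ((Function.Bijective.of_comp_iff' (eval_bijective_of_concentrated _ (-d)) _).1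
          (app_bijective_of_iso (fun a : A => actRight (k := k) (B := A) (op a)) f
            (actRight_twistRegular_bijective ν)))
      end_right := (Q_map_bijective_of_concentrated _ (-d) hr).comp
        ((Function.Bijective.of_comp_iff' (eval_bijective_of_concentrated _ (-d)) _).1
          (app_bijective_of_iso (fun a : A => actLeft (k := k) (C := Aᵐᵒᵖ) a) f
            (actLeft_twistRegular_bijective ν))) }

end RigidDualising

end HopfDuality

end

theorem proposition4p5 {k A : Type u} [Field k] [Ring A] [HopfAlgebra k A]
    [IsNoetherianRing A] [IsNoetherianRing Aᵐᵒᵖ]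
    (hS : Function.Bijective (HopfAlgebra.antipode k (A := A))) (d : ℕ)
    (hA : HopfDuality.IsASGorenstein k A (Bialgebra.counitAlgHom k A) d) :
    HopfDuality.IsRigidGorenstein k A d (HopfDuality.nakayamaAut hS hA) ∧
    HopfDuality.IsRigidDualisingComplex k A
      (((CochainComplex.singleFunctor (ModuleCat.{u} (HopfDuality.Env k A)) 0).obj
        (HopfDuality.twist (HopfDuality.nakayamaAut hS hA) AlgEquiv.refl
          (HopfDuality.regularBimodule k A)))⟦(d : ℤ)⟧) ∧
    Nonempty (HopfDuality.leftIntegral (Bialgebra.counitAlgHom k A) d ≅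
      HopfDuality.twist AlgEquiv.refl (HopfDuality.nakayamaAut hS hA)
        (HopfDuality.trivialBimodule (Bialgebra.counitAlgHom k A))) ∧
    Nonempty (HopfDuality.leftIntegral (Bialgebra.counitAlgHom k A) d ≅
      HopfDuality.twist AlgEquiv.refl (HopfDuality.integralWinding hA)
        (HopfDuality.trivialBimodule (Bialgebra.counitAlgHom k A))) := by
  -- The shift by d of a module in degree 0 is that module in degree -d, the form used for both the
  -- dualising and the rigidity statements.
  have g := ((CochainComplex.singleFunctors
    (ModuleCat.{u} (HopfDuality.Env k A))).shiftIso (d : ℤ) (-d) 0 (by omega)).app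
      (HopfDuality.twistRegular (HopfDuality.nakayamaAut hS hA))
  exact ⟨HopfDuality.isRigidGorenstein hS hA,
    ⟨HopfDuality.isDualisingComplex_of_iso_single _ d ⟨hA.injDim_left, hA.injDim_right⟩ _ g,
      HopfDuality.nonempty_rigid_iso hS hA _ g _⟩,
    HopfDuality.leftIntegral_iso_twist hA (HopfDuality.nakayamaAut hS hA)
      (HopfDuality.counit_leftWindingHom_antipode _),
    HopfDuality.leftIntegral_iso_twist hA (HopfDuality.integralWinding hA)
      (HopfDuality.counit_leftWindingHom _)⟩
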